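/- **Setting.** Let $X$ be a complex Banach space and $T_0$ a $\mathcal C_0$-semigroup on $X$. Let $X^{\odot}\subseteq X^*$ be the subspace of all $x^*$ for which $t\mapsto T_0^*(t)x^*$ is norm continuous on $[0,\infty)$, let $T_0^{\odot}$ be the restriction of $T_0^*$ to $X^{\odot}$, let $X^{\odot*}$ be the dual space of $X^{\odot}$ with the adjoint semigroup $T_0^{\odot*}$, and let $X^{\odot\odot}\subseteq X^{\odot*}$ be the subspace on which $T_0^{\odot*}$ is strongly continuous. Let $j:X\to X^{\odot*}$ be given by $\langle jx,x^{\odot}\rangle=\langle x^{\odot},x\rangle$, and assume that $X$ is sun-reflexive with respect to $T_0$, i.e. $j(X)=X^{\odot\odot}$. For a bounded linear $L:X\to X^{\odot*}$, the perturbation of $T_0$ by $L$ is the $\mathcal C_0$-semigroup $T$ on $X$ with $$T(t)x=T_0(t)x+j^{-1}\int_0^t T_0^{\odot*}(t-\tau)\,L\,T(\tau)x\,d\tau\qquad(t\ge 0,\ x\in X),$$ a weak$^\star$ integral. The space $X^{\odot}$ is the same for $T$ and $T_0$, and $A^{\odot*}$ denotes the weak$^\star$ generator of the semigroup $T^{\odot*}$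 on $X^{\odot*}$. Let $p\ge 0$ be an integer, $\mathbf X=X\times\mathbb C^p$ and $\mathbf T_0(t)=\operatorname{diag}(T_0(t),I_p)$, and identify $\mathbf X^{\odot*}$ with $X^{\odot*}\times\mathbb C^p$ in the natural way. Let $L_p:\mathbb C^p\to X^{\odot*}$ be linear, let $\mathbf T$ be the perturbation of $\mathbf T_0$ by $\mathbf L=\begin{pmatrix}L&L_p\\0&0\end{pmatrix}:\mathbf X\to\mathbf X^{\odot*}$, and let $\mathbf A^{\odot*}$ be the weak$^\star$ generator of $\mathbf T^{\odot*}$ on $\mathbf X^{\odot*}$. (For orientation: $\mathbf A^{\odot*}$ acts on $\mathcal D(A^{\odot*})\times\mathbb C^p$ by $\begin{pmatrix}A^{\odot*}&L_p\\0&0\end{pmatrix}$; this is not part of the claim.) Assume that $T_0$ is eventually compact and that $L$ is compact. For an operator $B$ let $\mathcal M_\lambda(B)=\bigcup_{n\ge 0}\mathcal N\big((B-\lambda I)^n\big)$ be its generalized eigenspace at $\lambda$, and let $R_z(B)=(zI-B)^{-1}$ be its resolvent. **Theorem 3.5.** A punctured neighbourhood of $0$ lies in the resolvent set of $A^{\odot*}$,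 and the residue $$\Gamma_0=\operatorname*{Res}_{z=0}\,z^{-1}R_z(A^{\odot*})$$ exists and is a bounded linear operator on $X^{\odot*}$ that maps into $X^{\odot\odot}$. For every $\lambda\in\mathbb C$ (in particular for every $\lambda$ in the spectrum of $\mathbf A^{\odot*}$), $$\mathcal M_\lambda(\mathbf A^{\odot*})=\begin{cases}\mathcal M_\lambda(A^{\odot*})\times\{0\}, &\lambda\neq 0,\\[2pt] \mathcal M_0(A^{\odot*})\times\{0\}\ \oplus\ \{(\Gamma_0L_p\alpha,\alpha):\alpha\in\mathbb C^p\}, &\lambda=0,\end{cases}$$ where $\oplus$ is a direct sum of subspaces. -/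

import Mathlib

open Filter Topology MeasureTheory
open scoped NNReal

noncomputable section

/-- A strongly continuous (`C₀`-) semigroup of bounded linear operators on a complex normed
space. -/
structure C0Semigroup (X : Type*) [NormedAddCommGroup X] [NormedSpace ℂ X] where
  toFun : ℝ≥0 → X →L[ℂ] X
  map_zero' : toFun 0 = ContinuousLinearMap.id ℂ X
  map_add' : ∀ s t, toFun (s + t) = (toFun s).comp (toFun t)
  continuous' : ∀ x, Continuous fun t => toFun t x

namespace C0Semigroup

variable {X : Type*} [NormedAddCommGroup X] [NormedSpace ℂ X]

instance : CoeFun (C0Semigroup X) (fun _ => ℝ≥0 → X →L[ℂ] X) := ⟨C0Semigroup.toFun⟩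

/-- The semigroup is eventually compact: some `T t` (and hence every later one) is a compact
operator. -/
def EventuallyCompact (T : C0Semigroup X) : Prop :=
  ∃ t : ℝ≥0, 0 < t ∧ IsCompactOperator (T t)

/-- The sun dual `X^⊙`: the maximal subspace of strong continuity of the adjoint semigroup, i.e.
all `ξ ∈ X*` such that `t ↦ T*(t) ξ = ξ ∘ T t` is norm continuous. -/
def sun (T : C0Semigroup X) : Submodule ℂ (StrongDual ℂ X) where
  carrier := {ξ | Continuous fun t : ℝ≥0 => ξ.comp (T t)}
  zero_mem' := by simpa using continuous_const
  add_mem' := by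
    intro a b ha hb
    simp only [Set.mem_ofPred_eq, ContinuousLinearMap.add_comp] at ha hb ⊢
    exact ha.add hb
  smul_mem' := by
    intro c a ha
    simp only [Set.mem_ofPred_eq, ContinuousLinearMap.smul_comp] at ha ⊢
    exact ha.const_smul c

theorem mem_sun {T : C0Semigroup X} {ξ : StrongDual ℂ X} :
    ξ ∈ T.sun ↔ Continuous fun t : ℝ≥0 => ξ.comp (T t) := Iff.rfl

/-- The sun dual is invariant under the adjoint semigroup. -/
theorem comp_mem_sun (T : C0Semigroup X) (t : ℝ≥0) {ξ : StrongDual ℂ X} (hξ : ξ ∈ T.sun) :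
    ξ.comp (T t) ∈ T.sun := by
  have h : Continuous fun s : ℝ≥0 => ξ.comp (T (t + s)) :=
    (mem_sun.1 hξ).comp (continuous_const.add continuous_id)
  rw [mem_sun]
  simpa [T.map_add', ContinuousLinearMap.comp_assoc] using h

/-- The sun dual `X^⊙` as a normed space of its own, with the norm of `X*`. -/
def Sun (T : C0Semigroup X) : Type _ := T.sun

instance (T : C0Semigroup X) : NormedAddCommGroup T.Sun :=
  inferInstanceAs (NormedAddCommGroup T.sun)

instance (T : C0Semigroup X) : NormedSpace ℂ T.Sun :=
  inferInstanceAs (NormedSpace ℂ T.sun)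

/-- An element of `X*` that lies in the sun dual, as an element of `X^⊙`. -/
def toSun (T : C0Semigroup X) (ξ : StrongDual ℂ X) (hξ : ξ ∈ T.sun) : T.Sun :=
  (⟨ξ, hξ⟩ : T.sun)

/-- The inclusion `X^⊙ → X*`. -/
def sunIncl (T : C0Semigroup X) : T.Sun →L[ℂ] StrongDual ℂ X :=
  LinearMap.mkContinuous
    { toFun := fun ξ => (show T.sun from ξ).1
      map_add' := fun _ _ => rfl
      map_smul' := fun _ _ => rfl } 1 (fun ξ => by rw [one_mul]; exact le_rfl)

theorem sunIncl_mem (T : C0Semigroup X) (ξ : T.Sun) : T.sunIncl ξ ∈ T.sun :=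
  (show T.sun from ξ).2

@[simp] theorem sunIncl_toSun (T : C0Semigroup X) (ξ : StrongDual ℂ X) (hξ : ξ ∈ T.sun) :
    T.sunIncl (T.toSun ξ hξ) = ξ := rfl

theorem norm_sunIncl (T : C0Semigroup X) (ξ : T.Sun) : ‖T.sunIncl ξ‖ = ‖ξ‖ := rfl

theorem sunIncl_injective (T : C0Semigroup X) : Function.Injective T.sunIncl :=
  Subtype.val_injective

theorem continuous_toSun (T : C0Semigroup X) {Y : Type*} [TopologicalSpace Y]
    {f : Y → StrongDual ℂ X} (hf : Continuous f) (h : ∀ y, f y ∈ T.sun) :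
    Continuous fun y => T.toSun (f y) (h y) :=
  Continuous.subtype_mk hf h

/-- A bounded linear map into `X*` with values in the sun dual, as a map into `X^⊙`. -/
def codSun (T : C0Semigroup X) {Y : Type*} [NormedAddCommGroup Y] [NormedSpace ℂ Y]
    (f : Y →L[ℂ] StrongDual ℂ X) (h : ∀ y, f y ∈ T.sun) : Y →L[ℂ] T.Sun where
  toFun y := T.toSun (f y) (h y)
  map_add' _ _ := T.sunIncl_injective (f.map_add _ _)
  map_smul' _ _ := T.sunIncl_injective (f.map_smul _ _)
  cont := T.continuous_toSun f.continuous h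

@[simp] theorem sunIncl_codSun (T : C0Semigroup X) {Y : Type*} [NormedAddCommGroup Y]
    [NormedSpace ℂ Y] (f : Y →L[ℂ] StrongDual ℂ X) (h : ∀ y, f y ∈ T.sun) (y : Y) :
    T.sunIncl (T.codSun f h y) = f y := rfl

/-- The semigroup `T^⊙`, the restriction of the adjoint semigroup to the sun dual of `T`,
`T^⊙(t) ξ = ξ ∘ T t`. The sun dual of `T` may be given here as the (equal) sun dual of another
semigroup `T₀`. -/
def sunSemigroupOn (T₀ T : C0Semigroup X) (h : T.sun = T₀.sun) : C0Semigroup T₀.Sun where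
  toFun t := T₀.codSun ((ContinuousLinearMap.precomp ℂ (T t)).comp T₀.sunIncl)
    (fun ξ => h ▸ T.comp_mem_sun t (h ▸ T₀.sunIncl_mem ξ))
  map_zero' := by
    ext ξ
    apply T₀.sunIncl_injective
    ext x
    simp [T.map_zero']
  map_add' s t := by
    ext ξ
    apply T₀.sunIncl_injective
    ext x
    rw [add_comm]
    simp [T.map_add']
  continuous' ξ := T₀.continuous_toSun (mem_sun.1 (h ▸ T₀.sunIncl_mem ξ)) _

theorem sunIncl_sunSemigroupOn (T₀ T : C0Semigroup X) (h : T.sun = T₀.sun) (t : ℝ≥0)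
    (ξ : T₀.Sun) :
    T₀.sunIncl (T₀.sunSemigroupOn T h t ξ) = (T₀.sunIncl ξ).comp (T t) := rfl

/-- The `C₀`-semigroup `T^⊙` on the sun dual `X^⊙`. -/
abbrev sunSemigroup (T : C0Semigroup X) : C0Semigroup T.Sun := T.sunSemigroupOn T rfl

/-- The space `X^{⊙*}`, the dual of the sun dual. -/
abbrev SunStar (T : C0Semigroup X) : Type _ := StrongDual ℂ T.Sun

/-- The space `X^{⊙⊙}`: the sun dual construction applied to the semigroup `T^⊙` on `X^⊙`. -/
abbrev sunSun (T : C0Semigroup X) : Submodule ℂ T.SunStar := T.sunSemigroup.sun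

/-- The canonical map `j : X → X^{⊙*}`, `⟨j x, ξ⟩ = ⟨ξ, x⟩`. -/
def j (T : C0Semigroup X) : X →L[ℂ] T.SunStar := T.sunIncl.flip

theorem j_apply (T : C0Semigroup X) (x : X) (ξ : T.Sun) : T.j x ξ = T.sunIncl ξ x := rfl

/-- `X` is sun-reflexive with respect to `T`: `j` maps `X` onto `X^{⊙⊙}`. -/
def SunReflexive (T : C0Semigroup X) : Prop := LinearMap.range T.j.toLinearMap = T.sunSun

/-- The (graph of the) weak* generator of the adjoint semigroup `T*` on `X*`: the pairs `(φ, ψ)`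
such that `h⁻¹ (T*(h) φ - φ) → ψ` in the weak* sense as `h ↓ 0`. -/
def weakStarGenerator (T : C0Semigroup X) : Submodule ℂ (StrongDual ℂ X × StrongDual ℂ X) where
  carrier := {q | ∀ x : X, Tendsto (fun h : ℝ => (h : ℂ)⁻¹ * (q.1 (T h.toNNReal x) - q.1 x))
    (𝓝[>] 0) (𝓝 (q.2 x))}
  zero_mem' := by intro x; simp
  add_mem' := by
    intro a b ha hb x
    refine ((ha x).add (hb x)).congr fun h => ?_
    simp only [Prod.fst_add, add_apply]
    ring
  smul_mem' := by
    intro c a ha x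
    refine ((ha x).const_mul c).congr fun h => ?_
    simp only [Prod.smul_fst, smul_apply, smul_eq_mul]
    ring

/-- `T` is the perturbation of the semigroup `T₀` by the bounded operator `L : X → X^{⊙*}`: it
solves the linear integral equation
`T(t) x = T₀(t) x + j⁻¹ ∫₀ᵗ T₀^{⊙*}(t - τ) L T(τ) x dτ`, with a weak* integral, i.e. after
application of `j` both sides agree when paired with every `ξ ∈ X^⊙`. -/
def IsPerturbation (T₀ : C0Semigroup X) (L : X →L[ℂ] T₀.SunStar) (T : C0Semigroup X) : Prop :=
  ∀ (t : ℝ≥0) (x : X) (ξ : T₀.Sun),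
    T₀.j (T t x) ξ = T₀.j (T₀ t x) ξ
      + ∫ τ in (0 : ℝ)..t, L (T τ.toNNReal x) (T₀.sunSemigroup (t - τ.toNNReal) ξ)

/-! ### The sun duals of `T₀` and of its perturbation coincide -/

theorem exists_bound [CompleteSpace X] (T : C0Semigroup X) (b : ℝ≥0) :
    ∃ M : ℝ, 0 ≤ M ∧ ∀ t ≤ b, ‖T t‖ ≤ M := by
  obtain ⟨M, hM⟩ := banach_steinhaus (g := fun t : Set.Icc (0 : ℝ≥0) b => T t) (by
    intro x
    obtain ⟨C, hC⟩ := (isCompact_Icc (a := (0 : ℝ≥0)) (b := b)).exists_bound_of_continuousOn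
      (T.continuous' x).continuousOn
    exact ⟨C, fun t => hC t t.2⟩)
  exact ⟨M, (norm_nonneg _).trans (hM ⟨0, by simp⟩), fun t ht => hM ⟨t, by simpa using ht⟩⟩

theorem mem_sun_of_tendsto [CompleteSpace X] (T : C0Semigroup X) {ξ : StrongDual ℂ X}
    (h : Tendsto (fun t : ℝ≥0 => ‖ξ.comp (T t) - ξ‖) (𝓝 0) (𝓝 0)) : ξ ∈ T.sun := by
  rw [mem_sun, Metric.continuous_iff]
  intro t ε hε
  obtain ⟨M, hM0, hM⟩ := T.exists_bound (t + 1)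
  have hε' : 0 < ε / (M + 1) := by positivity
  obtain ⟨δ, hδ, hδ'⟩ := Metric.tendsto_nhds_nhds.1 h _ hε'
  have key : ∀ s r : ℝ≥0, s ≤ t + 1 → (r : ℝ) < δ →
      ‖ξ.comp (T (s + r)) - ξ.comp (T s)‖ < ε := by
    intro s r hs hr
    have e : ξ.comp (T (s + r)) - ξ.comp (T s) = (ξ.comp (T r) - ξ).comp (T s) := by
      rw [add_comm, T.map_add', ContinuousLinearMap.sub_comp, ContinuousLinearMap.comp_assoc]
    have h1 : ‖ξ.comp (T r) - ξ‖ < ε / (M + 1) := by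
      have := @hδ' r (by simpa [NNReal.dist_eq] using hr)
      simpa using this
    rw [e]
    calc _ ≤ ‖ξ.comp (T r) - ξ‖ * ‖T s‖ := ContinuousLinearMap.opNorm_comp_le _ _
      _ ≤ (ε / (M + 1)) * M := by gcongr; exact hM s hs
      _ < (ε / (M + 1)) * (M + 1) := by gcongr; linarith
      _ = ε := by field_simp
  refine ⟨min δ 1, by positivity, fun a ha => ?_⟩
  rw [NNReal.dist_eq, lt_min_iff] at ha
  rcases le_total t a with hta | hta
  · obtain ⟨r, rfl⟩ := exists_add_of_le hta
    rw [dist_eq_norm]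
    refine key t r (by simp) ?_
    simpa using ha.1
  · obtain ⟨r, rfl⟩ := exists_add_of_le hta
    rw [dist_comm, dist_eq_norm]
    refine key a r (by rw [add_assoc]; simp) ?_
    simpa using ha.1

theorem tendsto_of_mem_sun (T : C0Semigroup X) {ξ : StrongDual ℂ X} (h : ξ ∈ T.sun) :
    Tendsto (fun t : ℝ≥0 => ‖ξ.comp (T t) - ξ‖) (𝓝 0) (𝓝 0) := by
  have h1 : Continuous fun t : ℝ≥0 => ‖ξ.comp (T t) - ξ‖ :=
    ((mem_sun.1 h).sub continuous_const).norm
  simpa [T.map_zero'] using h1.tendsto 0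

theorem continuous_toNNReal_apply (T : C0Semigroup X) (x : X) :
    Continuous fun s : ℝ => T s.toNNReal x := (T.continuous' x).comp continuous_real_toNNReal

/-- The averages `h⁻¹ ∫₀ʰ T(s)* ζ ds` lie in the sun dual, are bounded by a constant times `‖ζ‖`,
and converge weak* to `ζ`; consequently the sun dual is norming up to a constant. -/
theorem exists_norming [CompleteSpace X] (T : C0Semigroup X) :
    ∃ M : ℝ, 0 ≤ M ∧ ∀ (y : X) (C : ℝ), (∀ ξ ∈ T.sun, ‖ξ y‖ ≤ C * ‖ξ‖) → 0 ≤ C →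
      ‖y‖ ≤ M * C := by
  obtain ⟨M, hM0, hM⟩ := T.exists_bound 2
  refine ⟨M, hM0, fun y C hC hC0 => ?_⟩
  have hint : ∀ (x : X) (a b : ℝ), IntervalIntegrable (fun s : ℝ => T s.toNNReal x) volume a b :=
    fun x a b => (T.continuous_toNNReal_apply x).intervalIntegrable a b
  obtain ⟨ζ, hζ1, hζ⟩ := exists_dual_vector'' ℂ y
  have hbd : ∀ (x : X) (a b : ℝ), 0 ≤ a → a ≤ b → b ≤ 2 →
      ‖∫ s in a..b, T s.toNNReal x‖ ≤ M * ‖x‖ * (b - a) := by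
    intro x a b ha hab hb
    have := intervalIntegral.norm_integral_le_of_norm_le_const (a := a) (b := b)
      (f := fun s : ℝ => T s.toNNReal x) (C := M * ‖x‖) (by
        intro s hs
        rw [Set.uIoc_of_le hab] at hs
        refine ((T s.toNNReal).le_opNorm x).trans ?_
        gcongr
        refine hM _ ?_
        rw [Real.toNNReal_le_iff_le_coe]
        exact hs.2.trans hb)
    rwa [abs_of_nonneg (by linarith)] at this
  have hav : ∀ h : ℝ, 0 < h → h ≤ 1 →
      ‖ζ (((h : ℂ)⁻¹) • ∫ s in (0 : ℝ)..h, T s.toNNReal y)‖ ≤ M * C := by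
    intro h h0 h1
    let V : X →L[ℂ] X := LinearMap.mkContinuous
      { toFun := fun x => ∫ s in (0 : ℝ)..h, T s.toNNReal x
        map_add' := fun x z => by
          simp only [map_add]
          exact intervalIntegral.integral_add (hint x _ _) (hint z _ _)
        map_smul' := fun c x => by
          simp only [map_smul, RingHom.id_apply]
          exact intervalIntegral.integral_smul _ _ } (M * h) (by
        intro x
        have := hbd x 0 h le_rfl h0.le (by linarith)
        simpa [mul_right_comm] using this)
    have hV : ∀ x, V x = ∫ s in (0 : ℝ)..h, T s.toNNReal x := fun x => rfl
    have hVnorm : ‖V‖ ≤ M * h := LinearMap.mkContinuous_norm_le _ (by positivity) _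
    have hVT : ∀ (r : ℝ≥0) (x : X), (r : ℝ) ≤ 1 →
        V (T r x) - V x = (∫ s in h..(h + r), T s.toNNReal x) - ∫ s in (0 : ℝ)..r,
          T s.toNNReal x := by
      intro r x hr
      have e1 : V (T r x) = ∫ s in (r : ℝ)..(h + r), T s.toNNReal x := by
        have : V (T r x) = ∫ s in (0 : ℝ)..h, T (s + r).toNNReal x := by
          rw [hV]
          refine intervalIntegral.integral_congr fun s hs => ?_
          rw [Set.uIcc_of_le h0.le] at hs
          rw [Real.toNNReal_add hs.1 r.coe_nonneg, T.map_add', Real.toNNReal_coe]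
          rfl
        rw [this, intervalIntegral.integral_comp_add_right
          (fun s : ℝ => T s.toNNReal x) (r : ℝ), zero_add]
      rw [e1, hV, sub_eq_sub_iff_add_eq_add, add_comm,
        intervalIntegral.integral_add_adjacent_intervals (hint _ _ _) (hint _ _ _),
        add_comm (∫ s in h..(h + r), T s.toNNReal x),
        intervalIntegral.integral_add_adjacent_intervals (hint _ _ _) (hint _ _ _)]
    have hmem : ζ.comp V ∈ T.sun := by
      refine T.mem_sun_of_tendsto ?_
      have hb : ∀ᶠ r : ℝ≥0 in 𝓝 0, ‖(ζ.comp V).comp (T r) - ζ.comp V‖ ≤ 2 * M * r := by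
        filter_upwards [Iic_mem_nhds (show (0 : ℝ≥0) < 1 by norm_num)] with r hr
        have hr' : (r : ℝ) ≤ 1 := by exact_mod_cast hr
        refine ContinuousLinearMap.opNorm_le_bound _ (by positivity) fun x => ?_
        have e : ((ζ.comp V).comp (T r) - ζ.comp V) x = ζ (V (T r x) - V x) := by simp
        rw [e, hVT r x hr']
        have b1 := hbd x h (h + r) h0.le (by simp) (by linarith)
        have b2 := hbd x 0 r le_rfl r.2 (by linarith)
        refine (ζ.le_opNorm _).trans ?_
        calc _ ≤ 1 * (M * ‖x‖ * (h + r - h) + M * ‖x‖ * (r - 0)) := by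
              gcongr
              exact (norm_sub_le _ _).trans (add_le_add b1 b2)
          _ = 2 * M * r * ‖x‖ := by ring
      refine squeeze_zero' (Eventually.of_forall fun _ => norm_nonneg _) hb ?_
      have : Continuous fun r : ℝ≥0 => 2 * M * (r : ℝ) := by fun_prop
      simpa using this.tendsto 0
    have h2 := hC _ hmem
    have h3 : ‖ζ.comp V‖ ≤ M * h :=
      (ContinuousLinearMap.opNorm_comp_le _ _).trans (by nlinarith [norm_nonneg V])
    rw [map_smul, norm_smul, norm_inv, Complex.norm_real, Real.norm_of_nonneg h0.le]
    calc h⁻¹ * ‖ζ (∫ s in (0 : ℝ)..h, T s.toNNReal y)‖ ≤ h⁻¹ * (C * (M * h)) := by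
          gcongr
          exact h2.trans (by gcongr)
      _ = M * C := by field_simp
  have hlim : Tendsto (fun h : ℝ => ((h : ℂ)⁻¹) • ∫ s in (0 : ℝ)..h, T s.toNNReal y)
      (𝓝[>] 0) (𝓝 y) := by
    have hd : HasDerivAt (fun h : ℝ => ∫ s in (0 : ℝ)..h, T s.toNNReal y) y 0 := by
      have := intervalIntegral.integral_hasDerivAt_right (hint y 0 0)
        ((T.continuous_toNNReal_apply y).stronglyMeasurableAtFilter _ _)
        (T.continuous_toNNReal_apply y).continuousAt
      simpa [T.map_zero'] using this
    have h1 := hd.tendsto_slope_zero_right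
    refine h1.congr fun h => ?_
    simp only [zero_add, intervalIntegral.integral_same, sub_zero]
    rw [← Complex.ofReal_inv, Complex.coe_smul]
  have h4 := ((ζ.continuous.tendsto y).comp hlim).norm
  have h5 : ‖ζ y‖ ≤ M * C := by
    refine le_of_tendsto h4 ?_
    filter_upwards [Ioc_mem_nhdsGT (show (0 : ℝ) < 1 by norm_num)] with h hh
    exact hav h hh.1 hh.2
  simpa [hζ] using h5

/-- The sun duals of `T₀` and of its perturbation `T` are the same subspace of `X*`. -/
theorem IsPerturbation.sun_eq [CompleteSpace X] {T₀ T : C0Semigroup X}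
    {L : X →L[ℂ] T₀.SunStar} (hT : IsPerturbation T₀ L T) : T.sun = T₀.sun := by
  obtain ⟨M, hM0, hM⟩ := T.exists_bound 1
  obtain ⟨N, hN0, hN⟩ := T₀.exists_bound 1
  obtain ⟨K, hK0, hK⟩ := T₀.exists_norming
  have hdiff : ∀ (t : ℝ≥0), t ≤ 1 → ‖T t - T₀ t‖ ≤ K * (‖L‖ * M * N) * t := by
    intro t ht
    refine ContinuousLinearMap.opNorm_le_bound _ (by positivity) fun x => ?_
    have := hK ((T t - T₀ t) x) (‖L‖ * M * N * t * ‖x‖) ?_ (by positivity)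
    · calc _ ≤ _ := this
        _ = _ := by ring
    intro ξ hξ
    have e : ξ ((T t - T₀ t) x)
        = ∫ τ in (0 : ℝ)..t, L (T τ.toNNReal x)
            (T₀.sunSemigroup (t - τ.toNNReal) (T₀.toSun ξ hξ)) := by
      have := hT t x (T₀.toSun ξ hξ)
      have h1 : ξ (T t x) = ξ (T₀ t x) + _ := this
      rw [sub_apply, map_sub, h1, add_sub_cancel_left]
    rw [e]
    have := intervalIntegral.norm_integral_le_of_norm_le_const (a := (0 : ℝ)) (b := t)
      (f := fun τ : ℝ => L (T τ.toNNReal x) (T₀.sunSemigroup (t - τ.toNNReal) (T₀.toSun ξ hξ)))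
      (C := ‖L‖ * (M * ‖x‖) * (‖ξ‖ * N)) (by
        intro τ hτ
        rw [Set.uIoc_of_le t.coe_nonneg] at hτ
        have hτ1 : τ.toNNReal ≤ 1 := by
          rw [Real.toNNReal_le_iff_le_coe]
          exact hτ.2.trans (by exact_mod_cast ht)
        refine (ContinuousLinearMap.le_opNorm _ _).trans ?_
        have b1 : ‖L (T τ.toNNReal x)‖ ≤ ‖L‖ * (M * ‖x‖) := by
          refine (L.le_opNorm _).trans ?_
          gcongr
          refine ((T _).le_opNorm _).trans ?_
          gcongr
          exact hM _ hτ1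
        have b2 : ‖T₀.sunSemigroup (t - τ.toNNReal) (T₀.toSun ξ hξ)‖ ≤ ‖ξ‖ * N := by
          refine (ContinuousLinearMap.opNorm_comp_le ξ (T₀ (t - τ.toNNReal))).trans ?_
          gcongr
          exact hN _ (tsub_le_self.trans ht)
        gcongr)
    refine this.trans (le_of_eq ?_)
    rw [sub_zero, abs_of_nonneg t.coe_nonneg]
    ring
  have hlim : Tendsto (fun t : ℝ≥0 => ‖T t - T₀ t‖) (𝓝 0) (𝓝 0) := by
    have hb : ∀ᶠ t : ℝ≥0 in 𝓝 0, ‖T t - T₀ t‖ ≤ K * (‖L‖ * M * N) * t := by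
      filter_upwards [Iic_mem_nhds (show (0 : ℝ≥0) < 1 by norm_num)] with t ht
      exact hdiff t ht
    refine squeeze_zero' (Eventually.of_forall fun _ => norm_nonneg _) hb ?_
    have : Continuous fun r : ℝ≥0 => K * (‖L‖ * M * N) * (r : ℝ) := by fun_prop
    simpa using this.tendsto 0
  have main : ∀ S₁ S₂ : C0Semigroup X, Tendsto (fun t : ℝ≥0 => ‖S₁ t - S₂ t‖) (𝓝 0) (𝓝 0) →
      S₁.sun ≤ S₂.sun := by
    intro S₁ S₂ h ξ hξ
    refine S₂.mem_sun_of_tendsto ?_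
    have h1 := S₁.tendsto_of_mem_sun hξ
    have h2 := (h.const_mul ‖ξ‖).add h1
    simp only [mul_zero, add_zero] at h2
    refine squeeze_zero (fun _ => norm_nonneg _) (fun t => ?_) h2
    have e : ξ.comp (S₂ t) - ξ = -(ξ.comp (S₁ t - S₂ t)) + (ξ.comp (S₁ t) - ξ) := by
      rw [ContinuousLinearMap.comp_sub]; abel
    rw [e]
    refine (norm_add_le _ _).trans ?_
    rw [norm_neg]
    gcongr
    exact ContinuousLinearMap.opNorm_comp_le _ _
  refine le_antisymm (main T T₀ hlim) (main T₀ T ?_)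
  simpa only [norm_sub_rev] using hlim

/-- The (graph of the) operator `A^{⊙*}` on `X^{⊙*}`: the weak* generator of the semigroup
`T^{⊙*}`, the adjoint of the semigroup `T^⊙` on `X^⊙`. -/
def IsPerturbation.sunStarGenerator [CompleteSpace X] {T₀ T : C0Semigroup X}
    {L : X →L[ℂ] T₀.SunStar} (hT : IsPerturbation T₀ L T) :
    Submodule ℂ (T₀.SunStar × T₀.SunStar) :=
  (T₀.sunSemigroupOn T hT.sun_eq).weakStarGenerator

/-! ### The augmented setting -/

/-- The semigroup `diag(T₀(t), I_p)` on `X × ℂ^p`. -/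
def augment (T₀ : C0Semigroup X) (p : ℕ) : C0Semigroup (X × (Fin p → ℂ)) where
  toFun t := (T₀ t).prodMap (ContinuousLinearMap.id ℂ (Fin p → ℂ))
  map_zero' := by ext x <;> simp [T₀.map_zero']
  map_add' s t := by ext x <;> simp [T₀.map_add']
  continuous' x := (T₀.continuous' x.1).prodMk continuous_const

variable (T₀ : C0Semigroup X) (p : ℕ)

theorem inl_mem_sun {ξ : StrongDual ℂ (X × (Fin p → ℂ))} (hξ : ξ ∈ (T₀.augment p).sun) :
    ξ.comp (ContinuousLinearMap.inl ℂ X (Fin p → ℂ)) ∈ T₀.sun := by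
  have h := (ContinuousLinearMap.precomp ℂ
    (ContinuousLinearMap.inl ℂ X (Fin p → ℂ))).continuous.comp (mem_sun.1 hξ)
  rw [mem_sun]
  convert h using 1
  funext t
  ext x
  simp [augment]

theorem coprod_mem_sun {ξ : StrongDual ℂ X} (hξ : ξ ∈ T₀.sun) (η : StrongDual ℂ (Fin p → ℂ)) :
    ξ.coprod η ∈ (T₀.augment p).sun := by
  have h := ((ContinuousLinearMap.precomp ℂ
    (ContinuousLinearMap.fst ℂ X (Fin p → ℂ))).continuous.comp (mem_sun.1 hξ)).add
    (continuous_const (y := η.comp (ContinuousLinearMap.snd ℂ X (Fin p → ℂ))))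
  rw [mem_sun]
  convert h using 1
  funext t
  ext x <;> simp [augment]

/-- The restriction `(X × ℂ^p)^⊙ → X^⊙`, `ξ ↦ ξ(·, 0)`. -/
def sunInl : (T₀.augment p).Sun →L[ℂ] T₀.Sun :=
  T₀.codSun ((ContinuousLinearMap.precomp ℂ (ContinuousLinearMap.inl ℂ X (Fin p → ℂ))).comp
    (T₀.augment p).sunIncl) (fun ξ => T₀.inl_mem_sun p ((T₀.augment p).sunIncl_mem ξ))

/-- The extension `X^⊙ → (X × ℂ^p)^⊙`, `ξ ↦ ((x, α) ↦ ξ x)`. -/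
def sunFst : T₀.Sun →L[ℂ] (T₀.augment p).Sun :=
  (T₀.augment p).codSun ((ContinuousLinearMap.precomp ℂ
    (ContinuousLinearMap.fst ℂ X (Fin p → ℂ))).comp T₀.sunIncl) (fun ξ => by
      have h := T₀.coprod_mem_sun p (T₀.sunIncl_mem ξ) 0
      convert h using 1
      ext x <;> simp)

/-- The coordinate functional `(x, α) ↦ α i` as an element of `(X × ℂ^p)^⊙`. -/
def sunCoord (i : Fin p) : (T₀.augment p).Sun :=
  (T₀.augment p).toSun ((0 : StrongDual ℂ X).coprod (ContinuousLinearMap.proj i))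
    (T₀.coprod_mem_sun p T₀.sun.zero_mem _)

theorem sunInl_apply (ξ : (T₀.augment p).Sun) (x : X) :
    T₀.sunIncl (T₀.sunInl p ξ) x = (T₀.augment p).sunIncl ξ (x, 0) := rfl

theorem sunFst_apply (ξ : T₀.Sun) (y : X × (Fin p → ℂ)) :
    (T₀.augment p).sunIncl (T₀.sunFst p ξ) y = T₀.sunIncl ξ y.1 := rfl

theorem sunCoord_apply (i : Fin p) (y : X × (Fin p → ℂ)) :
    (T₀.augment p).sunIncl (T₀.sunCoord p i) y = y.2 i := zero_add _

theorem sun_decomp (ξ : (T₀.augment p).Sun) :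
    T₀.sunFst p (T₀.sunInl p ξ)
      + ∑ i, ((T₀.augment p).sunIncl ξ (0, Pi.single i 1)) • T₀.sunCoord p i = ξ := by
  apply (T₀.augment p).sunIncl_injective
  refine ContinuousLinearMap.ext fun y => ?_
  have h2 : (T₀.augment p).sunIncl ξ y = (T₀.augment p).sunIncl ξ (y.1, 0)
      + ∑ i, (T₀.augment p).sunIncl ξ (0, Pi.single i 1) * y.2 i := by
    have h3 : y = (y.1, 0) + ∑ i, y.2 i • ((0, Pi.single i 1) : X × (Fin p → ℂ)) := by
      refine Prod.ext ?_ ?_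
      · simp [Prod.fst_sum]
      · funext k
        simp [Prod.snd_sum, Pi.single_apply]
    conv_lhs => rw [h3]
    rw [map_add, map_sum]
    simp only [map_smul, smul_eq_mul, mul_comm]
  rw [h2, map_add, map_sum, add_apply, sunFst_apply, sunInl_apply]
  simp only [map_smul, sum_apply, smul_apply, sunCoord_apply, smul_eq_mul]

/-- The natural identification `X^{⊙*} × ℂ^p ≃ (X × ℂ^p)^{⊙*}`,
`⟨(φ, α), ξ⟩ = ⟨φ, ξ(·, 0)⟩ + ξ(0, α)`. -/
def augmentEquiv : (T₀.SunStar × (Fin p → ℂ)) ≃L[ℂ] (T₀.augment p).SunStar :=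
  ContinuousLinearEquiv.equivOfInverse
    ((ContinuousLinearMap.precomp ℂ (T₀.sunInl p)).coprod
      ((T₀.augment p).j.comp (ContinuousLinearMap.inr ℂ X (Fin p → ℂ))))
    ((ContinuousLinearMap.precomp ℂ (T₀.sunFst p)).prod
      (ContinuousLinearMap.pi fun i => ContinuousLinearMap.apply ℂ ℂ (T₀.sunCoord p i)))
    (by
      rintro ⟨φ, α⟩
      refine Prod.ext ?_ ?_
      · refine ContinuousLinearMap.ext fun ξ => ?_
        have h : T₀.sunInl p (T₀.sunFst p ξ) = ξ := T₀.sunIncl_injective rfl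
        change φ (T₀.sunInl p (T₀.sunFst p ξ))
          + (T₀.augment p).sunIncl (T₀.sunFst p ξ) (0, α) = φ ξ
        rw [h, sunFst_apply, map_zero, add_zero]
      · funext i
        have h : T₀.sunInl p (T₀.sunCoord p i) = 0 := by
          apply T₀.sunIncl_injective
          refine ContinuousLinearMap.ext fun x => ?_
          rw [sunInl_apply, sunCoord_apply, map_zero]
          rfl
        change φ (T₀.sunInl p (T₀.sunCoord p i))
          + (T₀.augment p).sunIncl (T₀.sunCoord p i) (0, α) = α i
        rw [h, sunCoord_apply, map_zero, zero_add])
    (by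
      intro Φ
      refine ContinuousLinearMap.ext fun ξ => ?_
      change Φ (T₀.sunFst p (T₀.sunInl p ξ))
        + (T₀.augment p).sunIncl ξ (0, fun i => Φ (T₀.sunCoord p i)) = Φ ξ
      have h := congrArg ((T₀.augment p).sunIncl · (0, fun i => Φ (T₀.sunCoord p i)))
        (T₀.sun_decomp p ξ)
      simp only [map_add, map_sum, map_smul, add_apply, sum_apply,
        smul_apply, sunCoord_apply, sunFst_apply, map_zero, zero_add] at h
      conv_rhs => rw [← T₀.sun_decomp p ξ]
      rw [← h, map_add, map_sum]
      simp only [map_smul])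

theorem augmentEquiv_apply (φ : T₀.SunStar) (α : Fin p → ℂ) (ξ : (T₀.augment p).Sun) :
    T₀.augmentEquiv p (φ, α) ξ
      = φ (T₀.sunInl p ξ) + (T₀.augment p).sunIncl ξ (0, α) := rfl

variable {T₀ p}

/-- The augmented perturbation `(x, α) ↦ (L x + L_p α, 0)`, with block form `[[L, L_p], [0, 0]]`,
as a bounded operator `X × ℂ^p → (X × ℂ^p)^{⊙*}`. -/
def augmentPerturbation (L : X →L[ℂ] T₀.SunStar) (Lp : (Fin p → ℂ) →L[ℂ] T₀.SunStar) :
    (X × (Fin p → ℂ)) →L[ℂ] (T₀.augment p).SunStar :=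
  (T₀.augmentEquiv p).toContinuousLinearMap.comp ((L.coprod Lp).prod 0)

end C0Semigroup

/-! ### Unbounded operators, given by their graphs -/

section Graph

variable {E : Type*} [NormedAddCommGroup E] [NormedSpace ℂ E]

/-- `R` is the bounded everywhere defined inverse `(z I - A)⁻¹`, where `A` is the operator with
graph `G`. -/
def IsResolventAt (G : Submodule ℂ (E × E)) (z : ℂ) (R : E →L[ℂ] E) : Prop :=
  (∀ φ, (R φ, z • R φ - φ) ∈ G) ∧ ∀ φ ψ, (φ, ψ) ∈ G → R (z • φ - ψ) = φ

/-- The resolvent set of the operator with graph `G`. -/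
def graphResolventSet (G : Submodule ℂ (E × E)) : Set ℂ := {z | ∃ R, IsResolventAt G z R}

open Classical in
/-- The resolvent operator `R_z(A) = (z I - A)⁻¹` of the operator `A` with graph `G`; the value
outside of the resolvent set is irrelevant and put equal to `0`. -/
def graphResolvent (G : Submodule ℂ (E × E)) (z : ℂ) : E →L[ℂ] E :=
  if h : ∃ R, IsResolventAt G z R then h.choose else 0

/-- The null space of `(A - μ I)ⁿ`, where `A` is the operator with graph `G`. -/
def graphKerPow (G : Submodule ℂ (E × E)) (μ : ℂ) : ℕ → Submodule ℂ E
  | 0 => ⊥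
  | n + 1 =>
    { carrier := {φ | ∃ ψ, (φ, ψ) ∈ G ∧ ψ - μ • φ ∈ graphKerPow G μ n}
      zero_mem' := ⟨0, G.zero_mem, by simp⟩
      add_mem' := by
        rintro a b ⟨ψ, h1, h2⟩ ⟨χ, h3, h4⟩
        refine ⟨ψ + χ, G.add_mem h1 h3, ?_⟩
        have := (graphKerPow G μ n).add_mem h2 h4
        convert this using 1
        module
      smul_mem' := by
        rintro c a ⟨ψ, h1, h2⟩
        refine ⟨c • ψ, G.smul_mem c h1, ?_⟩
        have := (graphKerPow G μ n).smul_mem c h2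
        convert this using 1
        module }

/-- The generalized eigenspace `M_μ(A)`, the union of the increasing sequence of null spaces of
`(A - μ I)ⁿ`, where `A` is the operator with graph `G`. -/
def graphGenEigenspace (G : Submodule ℂ (E × E)) (μ : ℂ) : Submodule ℂ E :=
  ⨆ n, graphKerPow G μ n

end Graph

/-- `a` is the residue at `c` of `f`, a function that is holomorphic in a punctured neighbourhood
of `c`. -/
def IsResidue {F : Type*} [NormedAddCommGroup F] [NormedSpace ℂ F] (f : ℂ → F) (c : ℂ) (a : F) :
    Prop :=
  ∃ ε > 0, DifferentiableOn ℂ f (Metric.ball c ε \ {c}) ∧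
    ∀ r, 0 < r → r < ε → (2 * Real.pi * Complex.I : ℂ)⁻¹ • (∮ z in C(c, r), f z) = a

end

/-! Write `A` for `A^{⊙*}`. Under `augmentEquiv` the augmented generator is the triangular operator
`(φ, α) ↦ (A φ + L_p α, 0)` (`augmentEquiv_mem_generator_iff`), which reduces the description of the
eigenspaces to algebra. For `μ ≠ 0` each application of the shifted operator multiplies the second
coordinate by `-μ`, so that coordinate must vanish. For `μ = 0` it is enough to find, for each `α`,
one `φ` with `A φ + L_p α` in `M_0(A)`; all other choices differ from it by elements of `M_0(A)`.

Such a `φ` comes from the Laurent expansion of `R_z(A)` at `0`. Integrating `A R_z = z R_z - 1`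
against `z⁻¹` over a small circle gives `A Γ = P - 1`, where `P` is the residue of `R_z`.
Integrating against `z ^ k` with `k ≥ 0` shows that `A` sends one principal-part coefficient to the
next. If `0` is at most a pole, these coefficients are eventually zero, so `P` maps into `M_0(A)`
and `φ = Γ L_p α` works (`exists_residue_graphResolvent`).

The analytic point is therefore that `0` is at most a pole. Some resolvent has the form `R_c = j S`,
and then `R_z = j (1 + (z - c) S j)⁻¹ S`. The operator `S j` need not be compact, but `1 + w S j` is
invertible modulo compact operators for every `w`: a Laplace transform of `T₀` truncated at a time
where `T₀` is compact provides the parametrix (`exists_parametrix`). Since `1 + w S j` is invertible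
at `w = 0`, an analytic Fredholm argument makes its inverse meromorphic on the whole plane
(`exists_pole_one_add_smul`). -/

namespace IsCompactOperator

/-! ### Riesz theory for compact perturbations of the identity. -/

variable {X : Type*} [NormedAddCommGroup X] [NormedSpace ℂ X] {C : X →L[ℂ] X}

theorem finiteDimensional_ker_one_sub (hC : IsCompactOperator C) :
    FiniteDimensional ℂ (1 - C).ker := by
  have hfix : ∀ x ∈ (1 - C).ker, C x = x := fun x hx => by
    have : x - C x = 0 := by simpa using hx
    exact (sub_eq_zero.1 this).symm
  have h := IsCompactOperator.restrict (f := C.toLinearMap) hC (V := (1 - C).ker)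
    (fun x hx => (hfix x hx).symm ▸ hx) (1 - C).isClosed_ker
  refine FiniteDimensional.of_isCompactOperator_id ?_
  have hid : (id : (1 - C).ker → (1 - C).ker) = C.toLinearMap.restrict
      (fun x hx => (hfix x hx).symm ▸ hx) := funext fun x => Subtype.ext (hfix x x.2).symm
  rw [hid]
  exact h

variable [CompleteSpace X]

theorem isUnit_one_sub_of_injective (hC : IsCompactOperator C)
    (h : Function.Injective (1 - C : X →L[ℂ] X)) : IsUnit (1 - C) := by
  rcases hC.hasEigenvalue_or_mem_resolventSet (one_ne_zero (α := ℂ)) with h1 | h1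
  · obtain ⟨x, hx⟩ := h1.exists_hasEigenvector
    refine absurd (h (a₁ := x) (a₂ := 0) ?_) hx.2
    have := hx.apply_eq_smul
    simp only [ContinuousLinearMap.coe_coe, one_smul] at this
    simp [this]
  · rw [spectrum.mem_resolventSet_iff, map_one] at h1
    exact h1

/-- The kernel is finite-dimensional, so it has a closed complement, which `1 - C` maps bijectively
onto `X`. The inverse `G` of this restriction is an injective compact perturbation of the identity,
hence a unit, and `1 - C` is then its inverse. -/
theorem injective_one_sub_of_surjective (hC : IsCompactOperator C)
    (h : Function.Surjective (1 - C : X →L[ℂ] X)) : Function.Injective (1 - C : X →L[ℂ] X) := by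
  have := hC.finiteDimensional_ker_one_sub
  obtain ⟨q, hq, hc⟩ := (Submodule.ClosedComplemented.of_finiteDimensional
    (1 - C).ker).exists_isClosed_isCompl
  have : CompleteSpace q := hq.completeSpace_coe
  have hinj : ((1 - C).comp q.subtypeL).ker = ⊥ := by
    refine LinearMap.ker_eq_bot'.2 fun x hx => ?_
    have : (x : X) ∈ (1 - C).ker ⊓ q := ⟨hx, x.2⟩
    rw [hc.inf_eq_bot] at this
    exact Subtype.ext this
  have hsurj : ((1 - C).comp q.subtypeL).range = ⊤ := by
    refine LinearMap.range_eq_top.2 fun y => ?_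
    obtain ⟨x, rfl⟩ := h y
    have hx : x ∈ (1 - C).ker ⊔ q := hc.sup_eq_top ▸ Submodule.mem_top
    obtain ⟨a, ha, b, hb, rfl⟩ := Submodule.mem_sup.1 hx
    refine ⟨⟨b, hb⟩, ?_⟩
    have ha' : (1 - C) a = 0 := ha
    change (1 - C) b = (1 - C) (a + b)
    rw [map_add, ha', zero_add]
  let e := ContinuousLinearEquiv.ofBijective _ hinj hsurj
  let G : X →L[ℂ] X := q.subtypeL.comp e.symm.toContinuousLinearMap
  have hG : (1 - C) * G = 1 := by
    ext x
    exact e.apply_symm_apply x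
  have hGeq : G = 1 - -(C * G) := by
    rw [sub_mul, one_mul, sub_eq_iff_eq_add] at hG
    rw [sub_neg_eq_add]
    exact hG
  have hGu : IsUnit G := by
    rw [hGeq]
    refine isUnit_one_sub_of_injective ?_ ?_
    · simpa using (hC.comp_clm G).neg
    · rw [← hGeq]
      intro x y hxy
      have h1 := congrArg (1 - C : X →L[ℂ] X) hxy
      have h2 : ∀ x, (1 - C) (G x) = x := fun x => DFunLike.congr_fun hG x
      rwa [h2, h2] at h1
  obtain ⟨u, hu⟩ := hGu
  have : 1 - C = ↑u⁻¹ := by rw [← hu] at hG; exact Units.eq_inv_of_mul_eq_one_right hG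
  have h3 : IsUnit (1 - C) := by rw [this]; exact Units.isUnit _
  exact (ContinuousLinearMap.isUnit_iff_bijective.1 h3).1

/-- A compact perturbation of the identity is a finite rank perturbation of an invertible
operator. -/
theorem exists_finiteRank_isUnit (hC : IsCompactOperator C) :
    ∃ F : X →L[ℂ] X, FiniteDimensional ℂ F.range ∧ IsUnit (1 - C - F) := by
  induction hd : Module.finrank ℂ (1 - C).ker using Nat.strong_induction_on generalizing C with
  | _ d ih =>
  by_cases hinj : Function.Injective (1 - C : X →L[ℂ] X)
  · refine ⟨0, ?_, by simpa using hC.isUnit_one_sub_of_injective hinj⟩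
    have : (0 : X →L[ℂ] X).range = ⊥ := LinearMap.range_zero
    rw [this]
    infer_instance
  have hsurj : ¬ Function.Surjective (1 - C : X →L[ℂ] X) := fun h =>
    hinj (hC.injective_one_sub_of_surjective h)
  obtain ⟨y, hy⟩ := not_forall.1 hsurj
  have hker : (1 - C).ker ≠ ⊥ := fun h => hinj (LinearMap.ker_eq_bot.1 h)
  obtain ⟨x, hx, hx0⟩ := (Submodule.ne_bot_iff _).1 hker
  obtain ⟨f, hf⟩ := SeparatingDual.exists_ne_zero (R := ℂ) hx0
  -- A rank-one correction with values outside the range of `1 - C`. A kernel vector `z` of `1 - C -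
  -- F₁` satisfies `(1 - C) z = f z • y`, which forces `f z = 0`. The new kernel thus lies in the
  -- old one and misses `x`, so the induction on its dimension proceeds.
  let F₁ : X →L[ℂ] X := f.smulRight y
  have hF₁ : IsCompactOperator F₁ := by
    have h1 : IsCompactOperator (f : X → ℂ) :=
      isCompactOperator_of_locallyCompactSpace_dom f
    exact h1.clm_comp (ContinuousLinearMap.toSpanSingleton ℂ y)
  have hC₁ : IsCompactOperator (C + F₁) := hC.add hF₁
  have hlt : (1 - (C + F₁)).ker < (1 - C).ker := by
    have hval : ∀ z ∈ (1 - (C + F₁)).ker, f z = 0 ∧ z ∈ (1 - C).ker := by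
      intro z hz
      have hz' : (1 - C) z = f z • y := by
        have : z - (C z + f z • y) = 0 := hz
        rw [← sub_sub, sub_eq_zero] at this
        exact this
      have hfz : f z = 0 := by
        by_contra hne
        exact hy ⟨(f z)⁻¹ • z, by rw [map_smul, hz', inv_smul_smul₀ hne]⟩
      exact ⟨hfz, by rw [hfz, zero_smul] at hz'; exact hz'⟩
    refine lt_of_le_of_ne (fun z hz => (hval z hz).2) fun he => ?_
    rw [← he] at hx
    exact hf (hval x hx).1
  have := hC.finiteDimensional_ker_one_sub
  obtain ⟨F, hF, hu⟩ := ih _ (hd ▸ Submodule.finrank_lt_finrank_of_lt hlt) hC₁ rfl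
  refine ⟨F₁ + F, ?_, by rw [sub_add_eq_sub_sub] at hu; rwa [← sub_sub]⟩
  have h1 : FiniteDimensional ℂ F₁.range := by
    have : F₁.range ≤ ℂ ∙ y := by
      rintro _ ⟨z, rfl⟩
      exact Submodule.smul_mem _ _ (Submodule.mem_span_singleton_self y)
    exact Submodule.finiteDimensional_of_le this
  have h2 : (F₁ + F).range ≤ F₁.range ⊔ F.range := LinearMap.range_add_le _ _
  exact Submodule.finiteDimensional_of_le h2

end IsCompactOperator

/-- A bounded operator with finite-dimensional range factors through some `ℂⁿ`. -/
theorem ContinuousLinearMap.exists_factor_of_finiteDimensional_range {X Y : Type*}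
    [NormedAddCommGroup X] [NormedSpace ℂ X] [NormedAddCommGroup Y] [NormedSpace ℂ Y]
    (F : X →L[ℂ] Y) [FiniteDimensional ℂ F.range] :
    ∃ (n : ℕ) (A : X →L[ℂ] (Fin n → ℂ)) (B : (Fin n → ℂ) →L[ℂ] Y), F = B.comp A := by
  let e := (Module.finBasis ℂ F.range).equivFun.toContinuousLinearEquiv
  refine ⟨_, e.toContinuousLinearMap.comp (F.codRestrict F.range fun x => ⟨x, rfl⟩),
    F.range.subtypeL.comp e.symm.toContinuousLinearMap, ?_⟩
  ext x
  exact congrArg Subtype.val (e.symm_apply_apply ⟨F x, x, rfl⟩).symm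

/-! ### Meromorphic inverses of operator families. -/

section AnalyticFredholm

variable {X : Type*} [NormedAddCommGroup X] [NormedSpace ℂ X] [CompleteSpace X]

/-- If `J` is analytic and invertible at `c`, and `J + B A` with a finite rank operator `B A` is
invertible at points accumulating at `c`, then `(J + B A)⁻¹` has at most a pole at `c`. -/
theorem exists_pole_of_add_finiteRank {J : ℂ → X →L[ℂ] X} {c : ℂ} (hJ : AnalyticAt ℂ J c)
    (hu : IsUnit (J c)) {m : ℕ} (A : X →L[ℂ] (Fin m → ℂ)) (B : (Fin m → ℂ) →L[ℂ] X)
    (hfr : ∃ᶠ z in 𝓝[≠] c, IsUnit (J z + B.comp A)) :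
    ∃ (n : ℕ) (H : ℂ → X →L[ℂ] X), ContinuousAt H c ∧ ∀ᶠ z in 𝓝[≠] c,
      (J z + B.comp A) * H z = (z - c) ^ n • 1 ∧ H z * (J z + B.comp A) = (z - c) ^ n • 1 := by
  obtain ⟨u, hu'⟩ := hu
  set G : ℂ → X →L[ℂ] X := fun z => Ring.inverse (J z) with hGdef
  have hG : AnalyticAt ℂ G c := by
    have h1 : AnalyticAt ℂ Ring.inverse (J c) := hu' ▸ analyticAt_inverse u
    exact h1.comp hJ
  have hJu : ∀ᶠ z in 𝓝 c, IsUnit (J z) :=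
    hJ.continuousAt.eventually_mem (by rw [← hu']; exact Units.nhds u)
  set K : ℂ → (Fin m → ℂ) →L[ℂ] (Fin m → ℂ) := fun z => A.comp ((G z).comp B) with hK
  have hKan : ∀ v i, AnalyticAt ℂ (fun z => K z v i) c := by
    intro v i
    let ev : (X →L[ℂ] X) →L[ℂ] ℂ := ((ContinuousLinearMap.proj i).comp A).comp
      (ContinuousLinearMap.apply ℂ X (B v))
    exact (ev.analyticAt _).comp hG
  -- By the Woodbury identity, `J + B A` has inverse `G - G B (1 + A G B)⁻¹ A G`, so its
  -- singularities are governed by the determinant of the finite matrix `D = 1 + A G B`.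
  set D : ℂ → Matrix (Fin m) (Fin m) ℂ := fun z => 1 + LinearMap.toMatrix' (K z).toLinearMap
    with hD
  have hDv : ∀ z v, (D z).mulVec v = v + A (G z (B v)) := by
    intro z v
    rw [hD]
    simp only [Matrix.add_mulVec, Matrix.one_mulVec, LinearMap.toMatrix'_mulVec]
    rfl
  have hDan : ∀ i j, AnalyticAt ℂ (fun z => D z i j) c := by
    intro i j
    simp only [hD, Matrix.add_apply, LinearMap.toMatrix'_apply]
    exact analyticAt_const.add (hKan _ _)
  have hdan : AnalyticAt ℂ (fun z => (D z).det) c := by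
    simp only [Matrix.det_apply]
    refine Finset.analyticAt_fun_sum _ fun σ _ => ?_
    exact (Finset.analyticAt_fun_prod _ fun i _ => hDan _ _).const_smul
  -- A null vector `v` of `D z` makes `G (B v)` a null vector of `J z + B A`. At a point where the
  -- latter is invertible this gives `G (B v) = 0`, and then `v = -A (G (B v)) = 0`.
  have hdne : ¬ ∀ᶠ z in 𝓝 c, (D z).det = 0 := by
    intro h0
    obtain ⟨z, hz1, hz2, hz3⟩ := (hfr.and_eventually
      ((hJu.and h0).filter_mono nhdsWithin_le_nhds)).exists
    obtain ⟨v, hv0, hv⟩ := Matrix.exists_mulVec_eq_zero_iff.2 hz3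
    rw [hDv] at hv
    have hGJ : J z (G z (B v)) = B v := by
      have := Ring.mul_inverse_cancel _ hz2
      exact DFunLike.congr_fun this (B v)
    have h1 : (J z + B.comp A) (G z (B v)) = 0 := by
      simp only [add_apply, ContinuousLinearMap.comp_apply, hGJ]
      rw [← map_add, hv, map_zero]
    have h2 : G z (B v) = 0 := by
      refine (ContinuousLinearMap.isUnit_iff_bijective.1 hz1).1 ?_
      rw [h1, map_zero]
    rw [h2, map_zero, add_zero] at hv
    exact hv0 hv
  obtain ⟨n, g, hg, hg0, hdg⟩ := (hdan.exists_eventuallyEq_pow_smul_nonzero_iff).2 hdne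
  set N : ℂ → (Fin m → ℂ) →L[ℂ] (Fin m → ℂ) := fun z =>
    LinearMap.toContinuousLinearMap (Matrix.mulVecLin (D z).adjugate) with hN
  have hNv : ∀ z v, N z v = (D z).adjugate.mulVec v := fun _ _ => rfl
  have hNc : ContinuousAt N c := by
    have h1 : ContinuousAt D c := by
      refine continuousAt_pi.2 fun i => continuousAt_pi.2 fun j => (hDan i j).continuousAt
    let ℓ : Matrix (Fin m) (Fin m) ℂ →ₗ[ℂ] ((Fin m → ℂ) →L[ℂ] (Fin m → ℂ)) :=
      LinearMap.toContinuousLinearMap.toLinearMap ∘ₗ Matrix.toLin'.toLinearMap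
    have hℓ : Continuous ℓ := ℓ.continuous_of_finiteDimensional
    exact ((hℓ.comp continuous_id.matrix_adjugate).continuousAt).comp h1
  -- The Woodbury formula multiplied by `(z - c) ^ n`. With `det D = (z - c) ^ n g` and `g c ≠ 0`,
  -- the factor `(z - c) ^ n D⁻¹` becomes `g⁻¹ adj D`, which is continuous at `c`.
  refine ⟨n, fun z => (z - c) ^ n • G z -
    (g z)⁻¹ • ((G z).comp (B.comp ((N z).comp (A.comp (G z))))), ?_, ?_⟩
  · have h1 : ContinuousAt (fun z : ℂ => (z - c) ^ n) c := by fun_prop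
    refine (h1.smul hG.continuousAt).sub ((hg.continuousAt.inv₀ hg0).smul ?_)
    exact hG.continuousAt.clm_comp (continuousAt_const.clm_comp
      (hNc.clm_comp (continuousAt_const.clm_comp hG.continuousAt)))
  · have hgne : ∀ᶠ z in 𝓝 c, g z ≠ 0 := hg.continuousAt.eventually_ne hg0
    refine Eventually.filter_mono nhdsWithin_le_nhds ?_
    filter_upwards [hJu, hgne, hdg] with z hz1 hz2 hz3
    have hJG : ∀ x, J z (G z x) = x := DFunLike.congr_fun (Ring.mul_inverse_cancel _ hz1)
    have hGJ : ∀ x, G z (J z x) = x := DFunLike.congr_fun (Ring.inverse_mul_cancel _ hz1)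
    have hDN : ∀ y, N z y + A (G z (B (N z y))) = ((z - c) ^ n * g z) • y := by
      intro y
      rw [← hDv, hNv, Matrix.mulVec_mulVec, Matrix.mul_adjugate, Matrix.smul_mulVec,
        Matrix.one_mulVec, hz3, smul_eq_mul]
    have hND : ∀ y, N z (y + A (G z (B y))) = ((z - c) ^ n * g z) • y := by
      intro y
      rw [← hDv, hNv, Matrix.mulVec_mulVec, Matrix.adjugate_mul, Matrix.smul_mulVec,
        Matrix.one_mulVec, hz3, smul_eq_mul]
    have hcan : (g z)⁻¹ * ((z - c) ^ n * g z) = (z - c) ^ n := by field_simp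
    constructor
    · ext x
      have h := hDN (A (G z x))
      set w := N z (A (G z x)) with hw
      have e : (J z + B.comp A) (((z - c) ^ n • G z -
          (g z)⁻¹ • ((G z).comp (B.comp ((N z).comp (A.comp (G z)))))) x)
          = (z - c) ^ n • x + (z - c) ^ n • B (A (G z x))
            - (g z)⁻¹ • B (w + A (G z (B w))) := by
        simp only [add_apply, sub_apply, smul_apply, ContinuousLinearMap.comp_apply, map_sub,
          map_smul, hJG, map_add, ← hw]
        module
      refine e.trans ?_
      rw [h, map_smul, smul_smul, hcan]
      simp
    · ext x
      have h := hND (A x)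
      have e : ((z - c) ^ n • G z -
          (g z)⁻¹ • ((G z).comp (B.comp ((N z).comp (A.comp (G z)))))) ((J z + B.comp A) x)
          = (z - c) ^ n • x + (z - c) ^ n • G z (B (A x))
            - (g z)⁻¹ • G z (B (N z (A x + A (G z (B (A x)))))) := by
        simp only [add_apply, sub_apply, smul_apply, ContinuousLinearMap.comp_apply,
          map_add, hGJ]
        module
      refine e.trans ?_
      rw [h, map_smul, map_smul, smul_smul, hcan]
      simp

/-- If the bounded operator `M c` has a two-sided inverse modulo compact operators and `M` is
invertible at points accumulating at `c`, then `M c` is a compact perturbation of an invertible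
operator, in product form. -/
theorem exists_isUnit_mul_one_sub_compact {M : ℂ → X →L[ℂ] X} {c : ℂ} (hM : ContinuousAt M c)
    {P : X →L[ℂ] X} (h1 : IsCompactOperator (P * M c - 1 : X →L[ℂ] X))
    (h2 : IsCompactOperator (M c * P - 1 : X →L[ℂ] X))
    (hfr : ∃ᶠ z in 𝓝[≠] c, IsUnit (M z)) :
    ∃ (U C : X →L[ℂ] X), IsUnit U ∧ IsCompactOperator C ∧ M c = (1 - C) * U := by
  have hc : Tendsto (fun z => 1 + P * (M z - M c)) (𝓝 c) (𝓝 1) := by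
    have : ContinuousAt (fun z => 1 + P * (M z - M c)) c := by fun_prop
    simpa [ContinuousAt] using this
  have hev : ∀ᶠ z in 𝓝 c, IsUnit (1 + P * (M z - M c)) :=
    hc.eventually (Units.nhds (1 : (X →L[ℂ] X)ˣ))
  obtain ⟨z, ⟨m, hm⟩, ⟨v, hv⟩⟩ := (hfr.and_eventually
    (hev.filter_mono nhdsWithin_le_nhds)).exists
  -- Here `P * M z = v + (P * M c - 1)` with `v` invertible because `z` is close to `c`. So the
  -- parametrix is itself invertible up to a compact operator, which amounts to saying that the
  -- index is zero.
  have hP : P = v * ↑m⁻¹ + (P * M c - 1) * ↑m⁻¹ := by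
    rw [← add_mul, hv, Units.eq_mul_inv_iff_mul_eq, hm]
    noncomm_ring
  have hMP : M c * (v * ↑m⁻¹) = 1 - (M c * ((P * M c - 1) * ↑m⁻¹) - (M c * P - 1)) := by
    conv_rhs => enter [2, 2, 1]; rw [hP]
    noncomm_ring
  refine ⟨↑(v * m⁻¹)⁻¹, M c * ((P * M c - 1) * ↑m⁻¹) - (M c * P - 1), Units.isUnit _,
    ((h1.comp_clm _).clm_comp (M c)).sub h2, ?_⟩
  rw [← hMP, ← Units.val_mul, mul_assoc, Units.mul_inv, mul_one]

/-- If the affine operator family `1 + z Q` is invertible modulo compact operators for all `z`, its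
inverse is meromorphic on the whole plane. -/
theorem exists_pole_one_add_smul (Q : X →L[ℂ] X)
    (hQ : ∀ z : ℂ, ∃ P : X →L[ℂ] X, IsCompactOperator (P * (1 + z • Q) - 1 : X →L[ℂ] X) ∧
      IsCompactOperator ((1 + z • Q) * P - 1 : X →L[ℂ] X)) (c : ℂ) :
    ∃ (n : ℕ) (H : ℂ → X →L[ℂ] X), ContinuousAt H c ∧ ∀ᶠ z in 𝓝[≠] c,
      (1 + z • Q) * H z = (z - c) ^ n • 1 ∧ H z * (1 + z • Q) = (z - c) ^ n • 1 := by
  have hcont : Continuous fun z : ℂ => 1 + z • Q := by fun_prop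
  have hopen : IsOpen {z : ℂ | IsUnit (1 + z • Q)} := Units.isOpen.preimage hcont
  have key : ∀ c : ℂ, (∃ᶠ z in 𝓝[≠] c, IsUnit (1 + z • Q)) →
      ∃ (n : ℕ) (H : ℂ → X →L[ℂ] X), ContinuousAt H c ∧ ∀ᶠ z in 𝓝[≠] c,
      (1 + z • Q) * H z = (z - c) ^ n • 1 ∧ H z * (1 + z • Q) = (z - c) ^ n • 1 := by
    intro c hfr
    obtain ⟨P, h1, h2⟩ := hQ c
    obtain ⟨U, C, hU, hC, hM⟩ := exists_isUnit_mul_one_sub_compact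
      (M := fun z => 1 + z • Q) hcont.continuousAt h1 h2 hfr
    obtain ⟨F, hF, hFu⟩ := hC.exists_finiteRank_isUnit
    obtain ⟨m, A, B, rfl⟩ := F.exists_factor_of_finiteDimensional_range
    -- The finite rank operator `B A` that repairs `1 - C` is split off. What remains is affine in
    -- `z` and invertible at `c`.
    have e : ∀ z : ℂ, 1 + z • Q
        = ((1 - C - B.comp A) * U + (z - c) • Q) + B.comp (A.comp U) := by
      intro z
      have : (1 + z • Q : X →L[ℂ] X) = (1 + c • Q) + (z - c) • Q := by module
      have h3 : B.comp (A.comp U) = (B.comp A) * U := rfl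
      rw [this, hM, h3]
      noncomm_ring
    have hJ : AnalyticAt ℂ (fun z : ℂ => (1 - C - B.comp A) * U + (z - c) • Q) c :=
      analyticAt_const.add ((analyticAt_id.sub analyticAt_const).smul analyticAt_const)
    have := exists_pole_of_add_finiteRank hJ (by simpa using hFu.mul hU) (A.comp U) B
      (by simpa only [← e] using hfr)
    simpa only [← e] using this
  have key2 : ∀ c : ℂ, (∃ᶠ z in 𝓝[≠] c, IsUnit (1 + z • Q)) →
      ∀ᶠ z in 𝓝[≠] c, IsUnit (1 + z • Q) := by
    intro c hfr
    obtain ⟨n, H, -, h⟩ := key c hfr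
    filter_upwards [h, self_mem_nhdsWithin] with z hz hzc
    have hne : (z - c) ^ n ≠ 0 := pow_ne_zero _ (sub_ne_zero.2 hzc)
    refine ⟨⟨_, ((z - c) ^ n)⁻¹ • H z, ?_, ?_⟩, rfl⟩
    · rw [mul_smul_comm, hz.1, inv_smul_smul₀ hne]
    · rw [smul_mul_assoc, hz.2, inv_smul_smul₀ hne]
  -- Connectedness of the plane spreads invertibility from `0`. Closedness is the dichotomy `key2`:
  -- invertibility at points accumulating at `c` already gives it on a punctured neighbourhood of
  -- `c`.
  have hclopen : IsClopen {c : ℂ | ∀ᶠ z in 𝓝[≠] c, IsUnit (1 + z • Q)} := by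
    constructor
    · refine isClosed_of_closure_subset fun c hc => key2 c ?_
      intro hnot
      obtain ⟨V, hV, hVo, hcV⟩ := eventually_nhds_iff.1 (eventually_nhdsWithin_iff.1 hnot)
      obtain ⟨w, hwV, hw⟩ := mem_closure_iff.1 hc V hVo hcV
      have h1 : ∀ᶠ z in 𝓝[≠] w, z ∈ V := nhdsWithin_le_nhds (hVo.mem_nhds hwV)
      have h2 : ∀ᶠ z in 𝓝[≠] w, z ≠ c := by
        by_cases hwc : w = c
        · rw [hwc]; exact self_mem_nhdsWithin
        · exact nhdsWithin_le_nhds (isOpen_ne.mem_nhds hwc)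
      obtain ⟨z, ⟨hz1, hz2⟩, hz3⟩ := ((h1.and h2).and hw).exists
      exact hV z hz1 hz2 hz3
    · rw [isOpen_iff_mem_nhds]
      intro c hc
      obtain ⟨V, hV, hVo, hcV⟩ := eventually_nhds_iff.1 (eventually_nhdsWithin_iff.1 hc)
      refine mem_of_superset (hVo.mem_nhds hcV) fun w hw => ?_
      by_cases hwc : w = c
      · rw [hwc]; exact hc
      · exact nhdsWithin_le_nhds (hopen.mem_nhds (hV w hw hwc))
  have h0 : (0 : ℂ) ∈ {c : ℂ | ∀ᶠ z in 𝓝[≠] c, IsUnit (1 + z • Q)} :=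
    nhdsWithin_le_nhds (hopen.mem_nhds (by simp))
  have huniv := hclopen.eq_univ ⟨0, h0⟩
  have hc : c ∈ {c : ℂ | ∀ᶠ z in 𝓝[≠] c, IsUnit (1 + z • Q)} := huniv ▸ Set.mem_univ c
  exact key c (Eventually.frequently hc)

end AnalyticFredholm

namespace C0Semigroup

/-! ### Weak* generators and truncated Laplace transforms. -/

section Generator

variable {Y : Type*} [NormedAddCommGroup Y] [NormedSpace ℂ Y] (S : C0Semigroup Y)

theorem continuous_exp_mul_apply (z : ℂ) (φ : StrongDual ℂ Y) (y : Y) :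
    Continuous fun s : ℝ => Complex.exp (-(z * s)) * φ (S s.toNNReal y) :=
  (by fun_prop : Continuous fun s : ℝ => Complex.exp (-(z * s))).mul
    (φ.continuous.comp (S.continuous_toNNReal_apply y))

/-- The truncated Laplace transform `∫₀ᵗ exp (-z s) S(s) ds` as a bounded operator. -/
theorem exists_truncatedLaplace [CompleteSpace Y] (z : ℂ) (t : ℝ≥0) :
    ∃ U : Y →L[ℂ] Y, ∀ (φ : StrongDual ℂ Y) (y : Y),
      φ (U y) = ∫ s in (0 : ℝ)..t, Complex.exp (-(z * s)) * φ (S s.toNNReal y) := by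
  obtain ⟨M, hM0, hM⟩ := S.exists_bound t
  have hc : ∀ y, Continuous fun s : ℝ => Complex.exp (-(z * s)) • S s.toNNReal y := fun y =>
    (by fun_prop : Continuous fun s : ℝ => Complex.exp (-(z * s))).smul
      (S.continuous_toNNReal_apply y)
  have hi : ∀ y, IntervalIntegrable (fun s : ℝ => Complex.exp (-(z * s)) • S s.toNNReal y)
      volume 0 t := fun y => (hc y).intervalIntegrable _ _
  let U : Y →L[ℂ] Y := LinearMap.mkContinuous
    { toFun := fun y => ∫ s in (0 : ℝ)..t, Complex.exp (-(z * s)) • S s.toNNReal y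
      map_add' := fun x y => by
        simp only [map_add, smul_add]
        exact intervalIntegral.integral_add (hi x) (hi y)
      map_smul' := fun c y => by
        simp only [map_smul, RingHom.id_apply, smul_comm _ c]
        exact intervalIntegral.integral_smul _ _ } (Real.exp (‖z‖ * t) * M * t) (by
      intro y
      have := intervalIntegral.norm_integral_le_of_norm_le_const (a := (0 : ℝ)) (b := t)
        (f := fun s : ℝ => Complex.exp (-(z * s)) • S s.toNNReal y)
        (C := Real.exp (‖z‖ * t) * (M * ‖y‖)) (by
          intro s hs
          rw [Set.uIoc_of_le t.coe_nonneg] at hs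
          rw [norm_smul]
          gcongr
          · refine (Complex.norm_exp_le_exp_norm _).trans ?_
            rw [norm_neg, norm_mul, Complex.norm_real, Real.norm_of_nonneg hs.1.le]
            gcongr
            exact hs.2
          · refine ((S s.toNNReal).le_opNorm y).trans ?_
            gcongr
            refine hM _ ?_
            rw [Real.toNNReal_le_iff_le_coe]
            exact hs.2)
      rw [sub_zero, abs_of_nonneg t.coe_nonneg] at this
      exact this.trans (le_of_eq (by ring)))
  refine ⟨U, fun φ y => ?_⟩
  have h := φ.intervalIntegral_comp_comm (hi y)
  simp only [map_smul, smul_eq_mul] at h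
  exact h.symm

variable {S}

/-- Shifting the orbit by `h` shifts the window of integration, so `φ (U (S h y))` equals `exp (z
h)` times the integral over `[h, t + h]`. Differentiating at `h = 0` yields the term `z φ U` and two
boundary terms. Thus the adjoint of `U` is a right inverse of `z - A` up to `exp (-z t) S*(t)`. -/
theorem truncatedLaplace_mem_weakStarGenerator {z : ℂ} {t : ℝ≥0} {U : Y →L[ℂ] Y}
    (hU : ∀ (φ : StrongDual ℂ Y) (y : Y),
      φ (U y) = ∫ s in (0 : ℝ)..t, Complex.exp (-(z * s)) * φ (S s.toNNReal y))
    (φ : StrongDual ℂ Y) :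
    (φ.comp U, z • φ.comp U - φ + Complex.exp (-(z * t)) • φ.comp (S t))
      ∈ S.weakStarGenerator := by
  intro y
  set g : ℝ → ℂ := fun s => Complex.exp (-(z * s)) * φ (S s.toNNReal y) with hg
  have hgc : Continuous g := S.continuous_exp_mul_apply z φ y
  have hgi : ∀ a b : ℝ, IntervalIntegrable g volume a b := fun a b => hgc.intervalIntegrable a b
  have hprim : ∀ a : ℝ, HasDerivAt (fun h : ℝ => ∫ s in (0 : ℝ)..h, g s) (g a) a := fun a =>
    intervalIntegral.integral_hasDerivAt_right (hgi 0 a)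
      (hgc.stronglyMeasurableAtFilter _ _) hgc.continuousAt
  have hexp : HasDerivAt (fun h : ℝ => Complex.exp (z * h)) z 0 := by
    have h1 : HasDerivAt (fun h : ℝ => z * (h : ℂ)) z 0 := by
      simpa using (Complex.ofRealCLM.hasDerivAt (x := (0 : ℝ))).const_mul z
    simpa using h1.cexp
  have h2 : HasDerivAt (fun h : ℝ => ∫ s in (0 : ℝ)..(t + h), g s) (g t) 0 := by
    have := (hprim ((t : ℝ) + 0)).comp_const_add (t : ℝ) 0
    simpa using this
  have h3 := (hexp.mul (h2.sub (hprim 0))).tendsto_slope_zero_right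
  have hg0 : g 0 = φ y := by simp [hg, S.map_zero']
  have hgt : g t = Complex.exp (-(z * t)) * φ (S t y) := by simp [hg]
  have hlim : z * ((∫ s in (0 : ℝ)..(t + 0 : ℝ), g s) - ∫ s in (0 : ℝ)..0, g s)
      + Complex.exp (z * (0 : ℝ)) * (g t - g 0)
      = (z • φ.comp U - φ + Complex.exp (-(z * t)) • φ.comp (S t)) y := by
    simp only [add_apply, sub_apply, smul_apply, ContinuousLinearMap.comp_apply, hU, smul_eq_mul,
      hg0, hgt, intervalIntegral.integral_same, add_zero, Complex.ofReal_zero, mul_zero,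
      Complex.exp_zero, one_mul, sub_zero]
    rw [hg]
    ring
  change Tendsto _ _ (𝓝 _) at h3
  rw [← hlim]
  refine h3.congr' ?_
  filter_upwards [self_mem_nhdsWithin] with h hh
  have hh0 : (0 : ℝ) < h := hh
  have e1 : φ (U (S h.toNNReal y))
      = Complex.exp (z * h) * ((∫ s in (0 : ℝ)..(t + h), g s) - ∫ s in (0 : ℝ)..h, g s) := by
    rw [intervalIntegral.integral_interval_sub_left (hgi _ _) (hgi _ _), hU]
    have e2 : ∀ s ∈ Set.uIcc (0 : ℝ) t, Complex.exp (-(z * s)) * φ (S s.toNNReal (S h.toNNReal y))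
        = Complex.exp (z * h) * g (s + h) := by
      intro s hs
      rw [Set.uIcc_of_le t.coe_nonneg] at hs
      rw [hg]
      simp only [Real.toNNReal_add hs.1 hh0.le, S.map_add', ContinuousLinearMap.comp_apply]
      rw [← mul_assoc, ← Complex.exp_add]
      congr 2
      push_cast
      ring
    rw [intervalIntegral.integral_congr e2, intervalIntegral.integral_const_mul,
      intervalIntegral.integral_comp_add_right (fun s : ℝ => g s) h, zero_add]
  have e3 : φ (U y) = ∫ s in (0 : ℝ)..t, g s := hU φ y
  simp only [Pi.mul_apply, Pi.sub_apply, zero_add, add_zero, intervalIntegral.integral_same,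
    Complex.ofReal_zero, mul_zero, Complex.exp_zero, one_mul, sub_zero,
    ContinuousLinearMap.comp_apply]
  rw [e1, e3, Complex.real_smul, Complex.ofReal_inv]

/-- The semigroup law moves the difference quotient from time `0` to time `s`. Only a right
derivative results, but for continuous orbits this suffices in the fundamental theorem of calculus.
-/
theorem hasDerivWithinAt_of_mem_weakStarGenerator {φ ψ : StrongDual ℂ Y}
    (h : (φ, ψ) ∈ S.weakStarGenerator) (y : Y) {s : ℝ} (hs : 0 ≤ s) :
    HasDerivWithinAt (fun s : ℝ => φ (S s.toNNReal y)) (ψ (S s.toNNReal y)) (Set.Ioi s) s := by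
  rw [hasDerivWithinAt_iff_tendsto_slope' (by simp)]
  have h1 : Tendsto (fun x : ℝ => x - s) (𝓝[>] s) (𝓝[>] 0) := by
    refine tendsto_nhdsWithin_iff.2 ⟨?_, ?_⟩
    · have : Continuous fun x : ℝ => x - s := by fun_prop
      simpa using (this.tendsto s).mono_left nhdsWithin_le_nhds
    · filter_upwards [self_mem_nhdsWithin] with x hx
      exact sub_pos.2 (Set.mem_Ioi.1 hx)
  refine ((h (S s.toNNReal y)).comp h1).congr' ?_
  filter_upwards [self_mem_nhdsWithin] with x hx
  have hx' : 0 ≤ x - s := (sub_pos.2 (Set.mem_Ioi.1 hx)).le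
  have e : S x.toNNReal y = S (x - s).toNNReal (S s.toNNReal y) := by
    conv_lhs => rw [← sub_add_cancel x s, Real.toNNReal_add hx' hs, S.map_add']
    rfl
  simp only [Function.comp_apply, slope_def_module]
  rw [e, ← Complex.ofReal_inv, Complex.real_smul]

theorem integral_of_mem_weakStarGenerator {φ ψ : StrongDual ℂ Y}
    (h : (φ, ψ) ∈ S.weakStarGenerator) (z : ℂ) (t : ℝ≥0) (y : Y) :
    ∫ s in (0 : ℝ)..t, Complex.exp (-(z * s)) * (z • φ - ψ) (S s.toNNReal y)
      = φ y - Complex.exp (-(z * t)) * φ (S t y) := by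
  have hd : ∀ s ∈ Set.Ioo (min (0 : ℝ) t) (max (0 : ℝ) t),
      HasDerivWithinAt (fun s : ℝ => -(Complex.exp (-(z * s)) * φ (S s.toNNReal y)))
        (Complex.exp (-(z * s)) * (z • φ - ψ) (S s.toNNReal y)) (Set.Ioi s) s := by
    intro s hs
    rw [min_eq_left t.coe_nonneg] at hs
    have h1 : HasDerivAt (fun s : ℝ => Complex.exp (-(z * s)))
        (Complex.exp (-(z * s)) * -z) s := by
      have h2 : HasDerivAt (fun h : ℝ => -(z * (h : ℂ))) (-z) s := by
        simpa using ((Complex.ofRealCLM.hasDerivAt (x := s)).const_mul z).fun_neg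
      exact h2.cexp
    have h3 := (h1.hasDerivWithinAt.mul
      (hasDerivWithinAt_of_mem_weakStarGenerator h y hs.1.le)).neg
    refine h3.congr_deriv ?_
    change _ = Complex.exp (-(z * s)) * (z * φ (S s.toNNReal y) - ψ (S s.toNNReal y))
    ring
  have := intervalIntegral.integral_eq_sub_of_hasDeriv_right
    (S.continuous_exp_mul_apply z φ y).neg.continuousOn hd
    ((S.continuous_exp_mul_apply z (z • φ - ψ) y).intervalIntegrable _ _)
  rw [this]
  simp [S.map_zero']
  ring

/-- The left-inverse counterpart of `truncatedLaplace_mem_weakStarGenerator`, with the same error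
term. -/
theorem comp_truncatedLaplace_of_mem_weakStarGenerator {z : ℂ} {t : ℝ≥0} {U : Y →L[ℂ] Y}
    (hU : ∀ (φ : StrongDual ℂ Y) (y : Y),
      φ (U y) = ∫ s in (0 : ℝ)..t, Complex.exp (-(z * s)) * φ (S s.toNNReal y))
    {φ ψ : StrongDual ℂ Y} (h : (φ, ψ) ∈ S.weakStarGenerator) :
    (z • φ - ψ).comp U = φ - Complex.exp (-(z * t)) • φ.comp (S t) := by
  refine ContinuousLinearMap.ext fun y => ?_
  rw [ContinuousLinearMap.comp_apply, hU, integral_of_mem_weakStarGenerator h]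
  rfl

/-- Elements of the domain of the weak* generator have Lipschitz continuous orbits. -/
theorem exists_norm_comp_sub_le_of_mem_weakStarGenerator [CompleteSpace Y] {φ ψ : StrongDual ℂ Y}
    (h : (φ, ψ) ∈ S.weakStarGenerator) :
    ∃ K : ℝ, ∀ t : ℝ≥0, t ≤ 1 → ‖φ.comp (S t) - φ‖ ≤ K * t := by
  obtain ⟨M, hM0, hM⟩ := S.exists_bound 1
  refine ⟨‖ψ‖ * M, fun t ht => ContinuousLinearMap.opNorm_le_bound _ (by positivity) fun y => ?_⟩
  have h1 := integral_of_mem_weakStarGenerator h 0 t y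
  have e : (φ.comp (S t) - φ) y = ∫ s in (0 : ℝ)..t, ψ (S s.toNNReal y) := by
    have h2 : (0 : ℂ) • φ - ψ = -ψ := by
      refine ContinuousLinearMap.ext fun v => ?_
      change 0 * φ v - ψ v = -ψ v
      ring
    rw [h2] at h1
    simp only [zero_mul, neg_zero, Complex.exp_zero, one_mul, neg_apply,
      intervalIntegral.integral_neg] at h1
    rw [sub_apply, ContinuousLinearMap.comp_apply, ← neg_sub, ← h1, neg_neg]
  rw [e]
  refine (intervalIntegral.norm_integral_le_of_norm_le_const (C := ‖ψ‖ * (M * ‖y‖)) ?_).trans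
    (le_of_eq ?_)
  · intro s hs
    rw [Set.uIoc_of_le t.coe_nonneg] at hs
    refine (ψ.le_opNorm _).trans ?_
    gcongr
    refine ((S s.toNNReal).le_opNorm y).trans ?_
    gcongr
    refine hM _ ?_
    rw [Real.toNNReal_le_iff_le_coe]
    exact hs.2.trans (by exact_mod_cast ht)
  · rw [sub_zero, abs_of_nonneg t.coe_nonneg]
    ring

end Generator

variable {X : Type*} [NormedAddCommGroup X] [NormedSpace ℂ X] [CompleteSpace X]

/-- Makes `X^⊙` a Banach space, so that the results on semigroups on complete spaces apply to `T^⊙`.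
Local boundedness of `T` makes norm limits of functionals locally uniform along orbits. -/
theorem isClosed_sun (T : C0Semigroup X) : IsClosed (T.sun : Set (StrongDual ℂ X)) := by
  refine isClosed_of_closure_subset fun ξ hξ => ?_
  refine continuous_iff_continuousAt.2 fun t =>
    continuousAt_of_locally_uniform_approx_of_continuousAt fun u hu => ?_
  obtain ⟨ε, hε, hεu⟩ := Metric.mem_uniformity_dist.1 hu
  obtain ⟨M, hM0, hM⟩ := T.exists_bound (t + 1)
  obtain ⟨η, hη, hd⟩ := Metric.mem_closure_iff.1 hξ (ε / (M + 1)) (by positivity)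
  refine ⟨Set.Iic (t + 1), Iic_mem_nhds (by simp), _, (mem_sun.1 hη).continuousAt, fun s hs => hεu ?_⟩
  rw [dist_eq_norm] at hd ⊢
  rw [← ContinuousLinearMap.sub_comp]
  calc _ ≤ ‖ξ - η‖ * ‖T s‖ := ContinuousLinearMap.opNorm_comp_le _ _
    _ ≤ (ε / (M + 1)) * M := by gcongr; exact hM s hs
    _ < (ε / (M + 1)) * (M + 1) := by gcongr; linarith
    _ = ε := by field_simp

instance completeSpace_sun (T : C0Semigroup X) : CompleteSpace T.Sun :=
  T.isClosed_sun.completeSpace_coe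

end C0Semigroup

/-! ### The embedding `j` and the generators of the perturbed and augmented semigroups. -/

namespace C0Semigroup

variable {X : Type*} [NormedAddCommGroup X] [NormedSpace ℂ X]

theorem sunSemigroupOn_j_apply {T₀ T : C0Semigroup X} (h : T.sun = T₀.sun) (t : ℝ≥0) (x : X)
    (ξ : T₀.Sun) : T₀.j x (T₀.sunSemigroupOn T h t ξ) = T₀.j (T t x) ξ := rfl

theorem j_comp_sunSemigroupOn {T₀ T : C0Semigroup X} (h : T.sun = T₀.sun) (t : ℝ≥0) (x : X) :
    (T₀.j x).comp (T₀.sunSemigroupOn T h t) = T₀.j (T t x) := rfl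

theorem range_j_le_sunSun (T : C0Semigroup X) : LinearMap.range T.j.toLinearMap ≤ T.sunSun := by
  rintro _ ⟨x, rfl⟩
  exact mem_sun.2 (T.j.continuous.comp (T.continuous' x))

theorem norm_comp_sunSemigroupOn_sub_le {T₀ T : C0Semigroup X} (h : T.sun = T₀.sun)
    (φ : T₀.SunStar) (t : ℝ≥0) :
    ‖φ.comp (T₀.sunSemigroup t) - φ.comp (T₀.sunSemigroupOn T h t)‖ ≤ ‖φ‖ * ‖T t - T₀ t‖ := by
  rw [← ContinuousLinearMap.comp_sub]
  refine (ContinuousLinearMap.opNorm_comp_le _ _).trans ?_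
  gcongr
  refine ContinuousLinearMap.opNorm_le_bound _ (norm_nonneg _) fun ξ => ?_
  have : ‖(T₀.sunIncl ξ).comp (T₀ t) - (T₀.sunIncl ξ).comp (T t)‖ ≤ ‖T t - T₀ t‖ * ‖ξ‖ := by
    rw [← ContinuousLinearMap.comp_sub, mul_comm, norm_sub_rev (T t)]
    exact ContinuousLinearMap.opNorm_comp_le _ _
  exact this

theorem isPerturbation_zero (T : C0Semigroup X) : IsPerturbation T 0 T := by
  intro t x ξ
  simp

/-- The quotient is the mean over `[0, h]` of a jointly continuous integrand whose value at the
origin is `L x ξ`. -/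
theorem IsPerturbation.tendsto_sub {T₀ T : C0Semigroup X} {L : X →L[ℂ] T₀.SunStar}
    (hT : IsPerturbation T₀ L T) (x : X) (ξ : T₀.Sun) :
    Tendsto (fun h : ℝ => (h : ℂ)⁻¹ * (T₀.j (T h.toNNReal x) ξ - T₀.j (T₀ h.toNNReal x) ξ))
      (𝓝[>] 0) (𝓝 (L x ξ)) := by
  let F : ℝ≥0 × ℝ≥0 → ℂ := fun q => L (T q.1 x) (T₀.sunSemigroup q.2 ξ)
  have hF : Continuous F := by
    have h1 : Continuous fun q : ℝ≥0 × ℝ≥0 => L (T q.1 x) :=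
      L.continuous.comp ((T.continuous' x).comp continuous_fst)
    exact h1.clm_apply ((T₀.sunSemigroup.continuous' ξ).comp continuous_snd)
  have hF0 : F 0 = L x ξ := by
    change L (T 0 x) (T₀.sunSemigroup 0 ξ) = _
    rw [T.map_zero', T₀.sunSemigroup.map_zero']
    rfl
  rw [Metric.tendsto_nhdsWithin_nhds]
  intro ε hε
  obtain ⟨δ, hδ, hδF⟩ := Metric.continuousAt_iff.1 (hF.continuousAt (x := 0)) (ε / 2) (half_pos hε)
  refine ⟨δ, hδ, fun h hh hhδ => ?_⟩
  have hh0 : (0 : ℝ) < h := hh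
  rw [Real.dist_eq, sub_zero, abs_of_pos hh0] at hhδ
  have hhn : ((h.toNNReal : ℝ≥0) : ℝ) = h := Real.coe_toNNReal h hh0.le
  have hne : (h : ℂ) ≠ 0 := by exact_mod_cast hh0.ne'
  have e := hT h.toNNReal x ξ
  rw [hhn] at e
  have hc : Continuous fun τ : ℝ => F (τ.toNNReal, h.toNNReal - τ.toNNReal) :=
    hF.comp (continuous_real_toNNReal.prodMk
      (continuous_const.sub continuous_real_toNNReal))
  have e1 : (h : ℂ)⁻¹ * (T₀.j (T h.toNNReal x) ξ - T₀.j (T₀ h.toNNReal x) ξ) - L x ξ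
      = (h : ℂ)⁻¹ * ∫ τ in (0 : ℝ)..h, (F (τ.toNNReal, h.toNNReal - τ.toNNReal) - L x ξ) := by
    rw [intervalIntegral.integral_sub (hc.intervalIntegrable _ _) intervalIntegrable_const,
      intervalIntegral.integral_const, sub_zero, Complex.real_smul, e, add_sub_cancel_left,
      mul_sub _ _ ((h : ℂ) * _), inv_mul_cancel_left₀ hne]
  have hb := intervalIntegral.norm_integral_le_of_norm_le_const (a := (0 : ℝ)) (b := h)
    (f := fun τ : ℝ => F (τ.toNNReal, h.toNNReal - τ.toNNReal) - L x ξ) (C := ε / 2) (by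
      intro τ hτ
      rw [Set.uIoc_of_le hh0.le] at hτ
      rw [← hF0, ← dist_eq_norm]
      refine (hδF ?_).le
      rw [Prod.dist_eq, max_lt_iff]
      constructor
      · rw [NNReal.dist_eq]
        simp only [Prod.fst_zero, NNReal.coe_zero, sub_zero, NNReal.abs_eq]
        rw [Real.coe_toNNReal _ hτ.1.le]
        exact hτ.2.trans_lt hhδ
      · rw [NNReal.dist_eq]
        simp only [Prod.snd_zero, NNReal.coe_zero, sub_zero, NNReal.abs_eq]
        refine lt_of_le_of_lt ?_ hhδ
        exact (NNReal.coe_le_coe.2 tsub_le_self).trans hhn.le)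
  rw [dist_eq_norm, e1, norm_mul, norm_inv, Complex.norm_real, Real.norm_of_nonneg hh0.le]
  rw [sub_zero, abs_of_pos hh0] at hb
  calc _ ≤ h⁻¹ * (ε / 2 * h) := by gcongr
    _ = ε / 2 := by field_simp
    _ < ε := half_lt_self hε

section Augment

variable (T₀ : C0Semigroup X) (p : ℕ)

theorem augment_j_apply (x : X) (α : Fin p → ℂ) :
    (T₀.augment p).j (x, α) = T₀.augmentEquiv p (T₀.j x, α) := by
  refine ContinuousLinearMap.ext fun ξ => ?_
  rw [augmentEquiv_apply, j_apply, j_apply, sunInl_apply, ← map_add, Prod.mk_add_mk, add_zero,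
    zero_add]

theorem augmentEquiv_apply_sunFst (φ : T₀.SunStar) (α : Fin p → ℂ) (ξ : T₀.Sun) :
    T₀.augmentEquiv p (φ, α) (T₀.sunFst p ξ) = φ ξ := by
  have h : T₀.sunInl p (T₀.sunFst p ξ) = ξ := T₀.sunIncl_injective rfl
  rw [augmentEquiv_apply, h, sunFst_apply, map_zero, add_zero]

theorem sunInl_sunCoord (i : Fin p) : T₀.sunInl p (T₀.sunCoord p i) = 0 := by
  apply T₀.sunIncl_injective
  refine ContinuousLinearMap.ext fun x => ?_
  rw [sunInl_apply, sunCoord_apply, map_zero]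
  rfl

theorem augmentEquiv_comp_sunSemigroup (φ : T₀.SunStar) (α : Fin p → ℂ) (t : ℝ≥0) :
    (T₀.augmentEquiv p (φ, α)).comp ((T₀.augment p).sunSemigroup t)
      = T₀.augmentEquiv p (φ.comp (T₀.sunSemigroup t), α) := by
  refine ContinuousLinearMap.ext fun ξ => ?_
  rw [ContinuousLinearMap.comp_apply, augmentEquiv_apply, augmentEquiv_apply,
    ContinuousLinearMap.comp_apply]
  have h1 : T₀.sunInl p ((T₀.augment p).sunSemigroup t ξ)
      = T₀.sunSemigroup t (T₀.sunInl p ξ) := by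
    apply T₀.sunIncl_injective
    refine ContinuousLinearMap.ext fun x => ?_
    rw [sunInl_apply, sunIncl_sunSemigroupOn, sunIncl_sunSemigroupOn]
    rfl
  have h2 : (T₀.augment p).sunIncl ((T₀.augment p).sunSemigroup t ξ) (0, α)
      = (T₀.augment p).sunIncl ξ (0, α) := by
    rw [sunIncl_sunSemigroupOn]
    change (T₀.augment p).sunIncl ξ (T₀ t 0, α) = _
    rw [map_zero]
  rw [h1, h2]

variable {T₀}

theorem SunReflexive.augment (hrefl : T₀.SunReflexive) : (T₀.augment p).SunReflexive := by
  refine le_antisymm (range_j_le_sunSun _) fun Φ hΦ => ?_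
  obtain ⟨⟨φ, α⟩, rfl⟩ := (T₀.augmentEquiv p).surjective Φ
  have hφ : φ ∈ T₀.sunSun := by
    have h1 := (ContinuousLinearMap.precomp ℂ (T₀.sunFst p)).continuous.comp (mem_sun.1 hΦ)
    refine mem_sun.2 (h1.congr fun t => ContinuousLinearMap.ext fun ξ => ?_)
    simp only [Function.comp_apply, augmentEquiv_comp_sunSemigroup]
    exact augmentEquiv_apply_sunFst _ _ _ _ _
  rw [← hrefl] at hφ
  obtain ⟨x, rfl⟩ := hφ
  exact ⟨(x, α), T₀.augment_j_apply p x α⟩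

theorem augmentEquiv_mem_weakStarGenerator_iff {φ ψ : T₀.SunStar} {α β : Fin p → ℂ} :
    (T₀.augmentEquiv p (φ, α), T₀.augmentEquiv p (ψ, β))
        ∈ (T₀.augment p).sunSemigroup.weakStarGenerator
      ↔ (φ, ψ) ∈ T₀.sunSemigroup.weakStarGenerator ∧ β = 0 := by
  have key : ∀ (h : ℝ) (ξ : (T₀.augment p).Sun),
      T₀.augmentEquiv p (φ, α) ((T₀.augment p).sunSemigroup h.toNNReal ξ)
        - T₀.augmentEquiv p (φ, α) ξ
      = φ (T₀.sunSemigroup h.toNNReal (T₀.sunInl p ξ)) - φ (T₀.sunInl p ξ) := by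
    intro h ξ
    rw [← ContinuousLinearMap.comp_apply (T₀.augmentEquiv p (φ, α)),
      augmentEquiv_comp_sunSemigroup, augmentEquiv_apply, augmentEquiv_apply,
      ContinuousLinearMap.comp_apply]
    ring
  constructor
  · intro H
    refine ⟨fun ξ => ?_, funext fun i => ?_⟩
    · have h1 := H (T₀.sunFst p ξ)
      have h2 : T₀.sunInl p (T₀.sunFst p ξ) = ξ := T₀.sunIncl_injective rfl
      have h3 := h1.congr fun r => congrArg _ (key r _)
      rw [h2, augmentEquiv_apply_sunFst] at h3
      exact h3
    · have h1 := H (T₀.sunCoord p i)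
      have h3 := h1.congr fun r => congrArg _ (key r _)
      rw [augmentEquiv_apply, sunInl_sunCoord, map_zero, map_zero, sunCoord_apply, zero_add] at h3
      refine tendsto_nhds_unique h3 (tendsto_const_nhds.congr fun r => ?_)
      rw [map_zero, map_zero, sub_zero, mul_zero]
      rfl
  · rintro ⟨H, rfl⟩ ξ
    have h0 : T₀.augmentEquiv p (ψ, 0) ξ = ψ (T₀.sunInl p ξ) := by
      have : (T₀.augment p).sunIncl ξ (0, 0) = 0 := map_zero ((T₀.augment p).sunIncl ξ)
      rw [augmentEquiv_apply, this, add_zero]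
    have h1 := (H (T₀.sunInl p ξ)).congr fun r => congrArg _ (key r ξ).symm
    rw [← h0] at h1
    exact h1

end Augment

variable [CompleteSpace X]

theorem exists_norm_le_j (T : C0Semigroup X) : ∃ M : ℝ, 0 ≤ M ∧ ∀ x, ‖x‖ ≤ M * ‖T.j x‖ := by
  obtain ⟨M, hM0, hM⟩ := T.exists_norming
  exact ⟨M, hM0, fun x => hM x _ (fun ξ hξ => (T.j x).le_opNorm (T.toSun ξ hξ)) (norm_nonneg _)⟩

theorem j_injective (T : C0Semigroup X) : Function.Injective T.j := by
  obtain ⟨M, hM0, hM⟩ := T.exists_norm_le_j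
  refine (injective_iff_map_eq_zero _).2 fun x hx => ?_
  have := hM x
  rw [hx, norm_zero, mul_zero] at this
  exact norm_le_zero_iff.1 this

/-- Bounded maps into `X^{⊙*}` with values in the range of `j` factor through `j`. -/
theorem exists_lift_j (T : C0Semigroup X) {E : Type*} [NormedAddCommGroup E] [NormedSpace ℂ E]
    (V : E →L[ℂ] T.SunStar) (hV : ∀ φ, ∃ x, V φ = T.j x) :
    ∃ S : E →L[ℂ] X, ∀ φ, T.j (S φ) = V φ := by
  choose f hf using hV
  obtain ⟨M, hM0, hM⟩ := T.exists_norm_le_j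
  refine ⟨LinearMap.mkContinuous
    { toFun := f
      map_add' := fun a b => T.j_injective (by rw [map_add, ← hf, ← hf, ← hf, map_add])
      map_smul' := fun c a => T.j_injective (by
        rw [RingHom.id_apply, map_smul, ← hf, ← hf, map_smul]) } (M * ‖V‖) fun a => ?_,
    fun a => (hf a).symm⟩
  refine (hM _).trans ?_
  change M * ‖T.j (f a)‖ ≤ _
  rw [← hf, mul_assoc]
  gcongr
  exact V.le_opNorm a

theorem IsPerturbation.exists_norm_sub_le {T₀ T : C0Semigroup X} {L : X →L[ℂ] T₀.SunStar}
    (hT : IsPerturbation T₀ L T) : ∃ K : ℝ, ∀ t : ℝ≥0, t ≤ 1 → ‖T t - T₀ t‖ ≤ K * t := by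
  obtain ⟨M, hM0, hM⟩ := T.exists_bound 1
  obtain ⟨N, hN0, hN⟩ := T₀.sunSemigroup.exists_bound 1
  obtain ⟨K, hK0, hK⟩ := T₀.exists_norm_le_j
  refine ⟨K * (‖L‖ * M * N), fun t ht =>
    ContinuousLinearMap.opNorm_le_bound _ (by positivity) fun x => ?_⟩
  have hb : ‖T₀.j ((T t - T₀ t) x)‖ ≤ ‖L‖ * M * N * t * ‖x‖ := by
    refine ContinuousLinearMap.opNorm_le_bound _ (by positivity) fun ξ => ?_
    have e : T₀.j ((T t - T₀ t) x) ξ = ∫ τ in (0 : ℝ)..t, L (T τ.toNNReal x)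
        (T₀.sunSemigroup (t - τ.toNNReal) ξ) := by
      rw [sub_apply, map_sub, sub_apply, hT t x ξ, add_sub_cancel_left]
    rw [e]
    refine (intervalIntegral.norm_integral_le_of_norm_le_const
      (C := ‖L‖ * (M * ‖x‖) * (N * ‖ξ‖)) ?_).trans (le_of_eq ?_)
    · intro τ hτ
      rw [Set.uIoc_of_le t.coe_nonneg] at hτ
      have hτ1 : τ.toNNReal ≤ 1 := by
        rw [Real.toNNReal_le_iff_le_coe]
        exact hτ.2.trans (by exact_mod_cast ht)
      refine (ContinuousLinearMap.le_opNorm _ _).trans ?_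
      gcongr
      · refine (L.le_opNorm _).trans ?_
        gcongr
        exact ((T _).le_opNorm _).trans (by gcongr; exact hM _ hτ1)
      · exact (ContinuousLinearMap.le_opNorm _ _).trans
          (by gcongr; exact hN _ (tsub_le_self.trans ht))
    · rw [sub_zero, abs_of_nonneg t.coe_nonneg]
      ring
  calc _ ≤ _ := hK _
    _ ≤ K * (‖L‖ * M * N * t * ‖x‖) := by gcongr
    _ = _ := by ring

/-- The domain of the weak* generator of the perturbed semigroup lies in the range of `j`. -/
theorem IsPerturbation.exists_eq_j {T₀ T : C0Semigroup X} (hrefl : T₀.SunReflexive)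
    {L : X →L[ℂ] T₀.SunStar} (hT : IsPerturbation T₀ L T) {φ ψ : T₀.SunStar}
    (h : (φ, ψ) ∈ hT.sunStarGenerator) : ∃ x, φ = T₀.j x := by
  -- The orbit of `φ` under `T^{⊙*}` is Lipschitz at `0`, and `T t - T₀ t` is `O(t)` in norm. So the
  -- orbit under `T₀^{⊙*}` is norm continuous at `0`, and sun-reflexivity applies.
  have hmem : φ ∈ T₀.sunSun := by
    refine mem_sun_of_tendsto _ ?_
    obtain ⟨K₁, h1⟩ := exists_norm_comp_sub_le_of_mem_weakStarGenerator h
    obtain ⟨K₂, h2⟩ := hT.exists_norm_sub_le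
    have hb : ∀ᶠ t : ℝ≥0 in 𝓝 0, ‖φ.comp (T₀.sunSemigroup t) - φ‖ ≤ (‖φ‖ * K₂ + K₁) * t := by
      filter_upwards [Iic_mem_nhds (show (0 : ℝ≥0) < 1 by norm_num)] with t ht
      calc _ = ‖(φ.comp (T₀.sunSemigroup t) - φ.comp (T₀.sunSemigroupOn T hT.sun_eq t))
            + (φ.comp (T₀.sunSemigroupOn T hT.sun_eq t) - φ)‖ := by rw [sub_add_sub_cancel]
        _ ≤ ‖φ‖ * (K₂ * t) + K₁ * t := by
          refine (norm_add_le _ _).trans (add_le_add ?_ (h1 t ht))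
          exact (norm_comp_sunSemigroupOn_sub_le _ _ _).trans (by gcongr; exact h2 t ht)
        _ = _ := by ring
    refine squeeze_zero' (Eventually.of_forall fun _ => norm_nonneg _) hb ?_
    have : Continuous fun r : ℝ≥0 => (‖φ‖ * K₂ + K₁) * (r : ℝ) := by fun_prop
    simpa using this.tendsto 0
  rw [← hrefl] at hmem
  obtain ⟨x, hx⟩ := hmem
  exact ⟨x, hx.symm⟩

theorem exists_eq_j {T : C0Semigroup X} (hrefl : T.SunReflexive) {φ ψ : T.SunStar}
    (h : (φ, ψ) ∈ T.sunSemigroup.weakStarGenerator) : ∃ x, φ = T.j x :=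
  T.isPerturbation_zero.exists_eq_j hrefl h

/-- The difference quotients for `T` and `T₀` at `j x` differ by a term tending weak* to `L x`, so
the generators differ by `L j⁻¹` on the range of `j`. -/
theorem IsPerturbation.j_mem_generator_iff {T₀ T : C0Semigroup X} {L : X →L[ℂ] T₀.SunStar}
    (hT : IsPerturbation T₀ L T) (x : X) (ψ : T₀.SunStar) :
    (T₀.j x, ψ) ∈ hT.sunStarGenerator
      ↔ (T₀.j x, ψ - L x) ∈ T₀.sunSemigroup.weakStarGenerator := by
  constructor
  · intro h ξ
    refine ((h ξ).sub (hT.tendsto_sub x ξ)).congr fun r => ?_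
    simp only [sunSemigroupOn_j_apply]
    ring
  · intro h ξ
    have := (h ξ).add (hT.tendsto_sub x ξ)
    rw [sub_apply, sub_add_cancel] at this
    refine this.congr fun r => ?_
    simp only [sunSemigroupOn_j_apply]
    ring

/-- The weak* generator of the augmented semigroup acts by `(φ, α) ↦ (A^{⊙*} φ + L_p α, 0)`. -/
theorem augmentEquiv_mem_generator_iff {T₀ : C0Semigroup X} {p : ℕ}
    (hrefl : T₀.SunReflexive) {L : X →L[ℂ] T₀.SunStar}
    {Lp : (Fin p → ℂ) →L[ℂ] T₀.SunStar} {T : C0Semigroup X} (hT : IsPerturbation T₀ L T)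
    {TT : C0Semigroup (X × (Fin p → ℂ))}
    (hTT : IsPerturbation (T₀.augment p) (augmentPerturbation L Lp) TT)
    {φ ψ : T₀.SunStar} {α β : Fin p → ℂ} :
    (T₀.augmentEquiv p (φ, α), T₀.augmentEquiv p (ψ, β)) ∈ hTT.sunStarGenerator
      ↔ (φ, ψ - Lp α) ∈ hT.sunStarGenerator ∧ β = 0 := by
  -- Either side of the equivalence puts `φ` into the range of `j`, where the generators are
  -- explicit.
  have key : ∀ x, φ = T₀.j x →
      ((T₀.augmentEquiv p (φ, α), T₀.augmentEquiv p (ψ, β)) ∈ hTT.sunStarGenerator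
        ↔ (φ, ψ - Lp α) ∈ hT.sunStarGenerator ∧ β = 0) := by
    rintro x rfl
    have e : T₀.augmentEquiv p (ψ, β) - augmentPerturbation L Lp (x, α)
        = T₀.augmentEquiv p (ψ - Lp α - L x, β) := by
      change T₀.augmentEquiv p (ψ, β) - T₀.augmentEquiv p (L x + Lp α, 0) = _
      rw [← map_sub, Prod.mk_sub_mk, sub_zero, sub_add_eq_sub_sub_swap]
    rw [← augment_j_apply, hTT.j_mem_generator_iff, e, augment_j_apply,
      augmentEquiv_mem_weakStarGenerator_iff, hT.j_mem_generator_iff]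
  constructor
  · intro h
    obtain ⟨⟨x, α'⟩, hx⟩ := hTT.exists_eq_j (hrefl.augment p) h
    rw [augment_j_apply] at hx
    exact (key x (congrArg Prod.fst ((T₀.augmentEquiv p).injective hx))).1 h
  · intro h
    obtain ⟨x, hx⟩ := hT.exists_eq_j hrefl h.1
    exact (key x hx).2 h

end C0Semigroup

/-! ### Generalized eigenspaces of triangular operators. -/

section GeneralizedEigenspace

variable {E : Type*} [NormedAddCommGroup E] [NormedSpace ℂ E] {G : Submodule ℂ (E × E)}

theorem graphKerPow_le_succ (μ : ℂ) (n : ℕ) : graphKerPow G μ n ≤ graphKerPow G μ (n + 1) := by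
  induction n with
  | zero => exact bot_le
  | succ n ih =>
    rintro φ ⟨ψ, h1, h2⟩
    exact ⟨ψ, h1, ih h2⟩

theorem mem_graphGenEigenspace {μ : ℂ} {φ : E} :
    φ ∈ graphGenEigenspace G μ ↔ ∃ n, φ ∈ graphKerPow G μ n :=
  Submodule.mem_iSup_of_directed _ (monotone_nat_of_le_succ (graphKerPow_le_succ μ)).directed_le

theorem mem_graphGenEigenspace_of_mem_graph {μ : ℂ} {φ ψ : E} (h : (φ, ψ) ∈ G)
    (hψ : ψ - μ • φ ∈ graphGenEigenspace G μ) : φ ∈ graphGenEigenspace G μ := by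
  obtain ⟨n, hn⟩ := mem_graphGenEigenspace.1 hψ
  exact mem_graphGenEigenspace.2 ⟨n + 1, ψ, h, hn⟩

variable {W E' : Type*} [NormedAddCommGroup W] [NormedSpace ℂ W] [NormedAddCommGroup E']
  [NormedSpace ℂ E'] {e : (E × W) ≃L[ℂ] E'} {B : W →L[ℂ] E} {G' : Submodule ℂ (E' × E')}

theorem mem_graphKerPow_of_triangular
    (hG : ∀ φ ψ α β, (e (φ, α), e (ψ, β)) ∈ G' ↔ (φ, ψ - B α) ∈ G ∧ β = 0) {μ : ℂ} {n : ℕ} {φ : E} :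
    e (φ, 0) ∈ graphKerPow G' μ n ↔ φ ∈ graphKerPow G μ n := by
  induction n generalizing φ with
  | zero =>
    change e (φ, 0) ∈ (⊥ : Submodule ℂ E') ↔ φ ∈ (⊥ : Submodule ℂ E)
    simp
  | succ n ih =>
    have hsub : ∀ ψ, e (ψ, 0) - μ • e (φ, 0) = e (ψ - μ • φ, 0) := by
      intro ψ
      rw [← map_smul, ← map_sub]
      simp
    constructor
    · rintro ⟨Ψ, h1, h2⟩
      obtain ⟨⟨ψ, β⟩, rfl⟩ := e.surjective Ψ
      obtain ⟨h3, rfl⟩ := (hG _ _ _ _).1 h1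
      rw [map_zero, sub_zero] at h3
      rw [hsub] at h2
      exact ⟨ψ, h3, ih.1 h2⟩
    · rintro ⟨ψ, h1, h2⟩
      refine ⟨e (ψ, 0), (hG _ _ _ _).2 ⟨by rwa [map_zero, sub_zero], rfl⟩, ?_⟩
      rw [hsub]
      exact ih.2 h2

theorem mem_graphGenEigenspace_of_triangular
    (hG : ∀ φ ψ α β, (e (φ, α), e (ψ, β)) ∈ G' ↔ (φ, ψ - B α) ∈ G ∧ β = 0) {μ : ℂ} {φ : E} :
    e (φ, 0) ∈ graphGenEigenspace G' μ ↔ φ ∈ graphGenEigenspace G μ := by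
  simp only [mem_graphGenEigenspace, mem_graphKerPow_of_triangular hG]

theorem snd_eq_zero_of_mem_graphKerPow
    (hG : ∀ φ ψ α β, (e (φ, α), e (ψ, β)) ∈ G' ↔ (φ, ψ - B α) ∈ G ∧ β = 0) {μ : ℂ} (hμ : μ ≠ 0)
    {n : ℕ} {φ : E} {α : W} (h : e (φ, α) ∈ graphKerPow G' μ n) : α = 0 := by
  induction n generalizing φ α with
  | zero =>
    have h0 : e (φ, α) ∈ (⊥ : Submodule ℂ E') := h
    have h1 : (φ, α) = 0 := e.injective (by rw [(Submodule.mem_bot ℂ).1 h0, map_zero])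
    exact congrArg Prod.snd h1
  | succ n ih =>
    obtain ⟨Ψ, h1, h2⟩ := h
    obtain ⟨⟨ψ, β⟩, rfl⟩ := e.surjective Ψ
    obtain ⟨-, rfl⟩ := (hG _ _ _ _).1 h1
    rw [← map_smul, ← map_sub] at h2
    have h3 : (0 : W) - μ • α = 0 := ih h2
    rw [zero_sub, neg_eq_zero] at h3
    exact (smul_eq_zero.1 h3).resolve_left hμ

theorem mem_map_prod_bot_iff {e : (E × W) ≃L[ℂ] E'} {M : Submodule ℂ E} {φ : E} {α : W} :
    e (φ, α) ∈ (M.prod ⊥).map e.toLinearMap ↔ φ ∈ M ∧ α = 0 := by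
  constructor
  · rintro ⟨⟨φ', α'⟩, ⟨h1, h2⟩, h3⟩
    obtain ⟨rfl, rfl⟩ := Prod.mk.inj (e.injective h3)
    exact ⟨h1, h2⟩
  · rintro ⟨h1, rfl⟩
    exact ⟨(φ, 0), ⟨h1, rfl⟩, rfl⟩

theorem graphGenEigenspace_triangular_of_ne_zero
    (hG : ∀ φ ψ α β, (e (φ, α), e (ψ, β)) ∈ G' ↔ (φ, ψ - B α) ∈ G ∧ β = 0) {μ : ℂ} (hμ : μ ≠ 0) :
    graphGenEigenspace G' μ = ((graphGenEigenspace G μ).prod ⊥).map e.toLinearMap := by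
  ext Φ
  obtain ⟨⟨φ, α⟩, rfl⟩ := e.surjective Φ
  rw [mem_map_prod_bot_iff]
  constructor
  · intro h
    obtain ⟨n, hn⟩ := mem_graphGenEigenspace.1 h
    obtain rfl := snd_eq_zero_of_mem_graphKerPow hG hμ hn
    exact ⟨(mem_graphGenEigenspace_of_triangular hG).1 h, rfl⟩
  · rintro ⟨h, rfl⟩
    exact (mem_graphGenEigenspace_of_triangular hG).2 h

/-- The relation `A Γ = P - 1` sends `(Γ B α, α)` to `(P B α, 0)`, which lies in the generalized
eigenspace. Subtracting this lift from an element with second coordinate `α` leaves an element of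
the form `(φ, 0)`. -/
theorem graphGenEigenspace_triangular_zero
    (hG : ∀ φ ψ α β, (e (φ, α), e (ψ, β)) ∈ G' ↔ (φ, ψ - B α) ∈ G ∧ β = 0) {Γ P : E →L[ℂ] E}
    (hΓ : ∀ φ, (Γ φ, P φ - φ) ∈ G) (hP : ∀ φ, P φ ∈ graphGenEigenspace G 0) :
    graphGenEigenspace G' 0 = ((graphGenEigenspace G 0).prod ⊥).map e.toLinearMap
      ⊔ LinearMap.range (e.toLinearMap ∘ₗ ((Γ ∘L B).toLinearMap.prod LinearMap.id)) := by
  have hlift : ∀ α, e (Γ (B α), α) ∈ graphGenEigenspace G' 0 := by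
    intro α
    have h1 : (e (Γ (B α), α), e (P (B α), 0)) ∈ G' := (hG _ _ _ _).2 ⟨hΓ _, rfl⟩
    refine mem_graphGenEigenspace_of_mem_graph h1 ?_
    rw [zero_smul, sub_zero]
    exact (mem_graphGenEigenspace_of_triangular hG).2 (hP _)
  refine le_antisymm (fun Φ hΦ => ?_) (sup_le ?_ ?_)
  · obtain ⟨⟨φ, α⟩, rfl⟩ := e.surjective Φ
    have hsub : e (φ - Γ (B α), 0) = e (φ, α) - e (Γ (B α), α) := by
      rw [← map_sub]
      simp
    have h2 : e (φ - Γ (B α), 0) ∈ graphGenEigenspace G' 0 :=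
      hsub ▸ Submodule.sub_mem _ hΦ (hlift α)
    rw [eq_add_of_sub_eq hsub.symm]
    exact Submodule.add_mem_sup
      (mem_map_prod_bot_iff.2 ⟨(mem_graphGenEigenspace_of_triangular hG).1 h2, rfl⟩) ⟨α, rfl⟩
  · rintro _ ⟨⟨φ, α⟩, ⟨h1, h2⟩, rfl⟩
    obtain rfl : α = 0 := h2
    exact (mem_graphGenEigenspace_of_triangular hG).2 h1
  · rintro _ ⟨α, rfl⟩
    exact hlift α

theorem disjoint_map_prod_bot_range (e : (E × W) ≃L[ℂ] E') (M : Submodule ℂ E) (f : W →ₗ[ℂ] E) :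
    Disjoint ((M.prod ⊥).map e.toLinearMap)
      (LinearMap.range (e.toLinearMap ∘ₗ (f.prod LinearMap.id))) := by
  rw [Submodule.disjoint_def]
  rintro _ h ⟨α, rfl⟩
  obtain ⟨-, rfl⟩ := mem_map_prod_bot_iff.1 (show e (f α, α) ∈ _ from h)
  exact map_zero _

end GeneralizedEigenspace

/-! ### Resolvents of operators given by graphs. -/

section Resolvent

variable {E : Type*} [NormedAddCommGroup E] [NormedSpace ℂ E] {G : Submodule ℂ (E × E)}

theorem IsResolventAt.unique {z : ℂ} {R R' : E →L[ℂ] E} (h : IsResolventAt G z R)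
    (h' : IsResolventAt G z R') : R = R' := by
  refine ContinuousLinearMap.ext fun φ => ?_
  have := h'.2 _ _ (h.1 φ)
  rw [sub_sub_cancel] at this
  exact this.symm

theorem IsResolventAt.graphResolvent_eq {z : ℂ} {R : E →L[ℂ] E} (h : IsResolventAt G z R) :
    graphResolvent G z = R := by
  have h' : ∃ R, IsResolventAt G z R := ⟨R, h⟩
  rw [graphResolvent, dif_pos h']
  exact h'.choose_spec.unique h

theorem IsResolventAt.mem_iff {z : ℂ} {R : E →L[ℂ] E} (h : IsResolventAt G z R) {φ ψ : E} :
    (φ, ψ) ∈ G ↔ R (z • φ - ψ) = φ := by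
  refine ⟨h.2 φ ψ, fun h1 => ?_⟩
  have := h.1 (z • φ - ψ)
  rwa [h1, sub_sub_cancel] at this

/-- If the resolvent at `c` factors as `J ∘ S`, then the resolvent at `z` is
`J ∘ (1 + (z - c) S J)⁻¹ ∘ S`. -/
theorem IsResolventAt.of_factor {X : Type*} [NormedAddCommGroup X] [NormedSpace ℂ X] {c : ℂ}
    {J : X →L[ℂ] E} {S : E →L[ℂ] X} (h : IsResolventAt G c (J.comp S)) {z : ℂ} {H : X →L[ℂ] X}
    (h1 : (1 + (z - c) • S.comp J) * H = 1) (h2 : H * (1 + (z - c) • S.comp J) = 1) :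
    IsResolventAt G z (J.comp (H.comp S)) := by
  have h1' : ∀ x, H x + (z - c) • S (J (H x)) = x := DFunLike.congr_fun h1
  have h2' : ∀ x, H (x + (z - c) • S (J x)) = x := DFunLike.congr_fun h2
  constructor
  · intro φ
    rw [h.mem_iff]
    simp only [ContinuousLinearMap.comp_apply]
    congr 1
    have e : c • J (H (S φ)) - (z • J (H (S φ)) - φ) = φ - (z - c) • J (H (S φ)) := by module
    rw [e, map_sub, map_smul, sub_eq_iff_eq_add]
    exact (h1' _).symm
  · intro φ ψ hφ
    have h3 := h.mem_iff.1 hφ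
    simp only [ContinuousLinearMap.comp_apply] at h3 ⊢
    have e : z • φ - ψ = (c • φ - ψ) + (z - c) • φ := by module
    have e2 : S (z • φ - ψ) = S (c • φ - ψ) + (z - c) • S (J (S (c • φ - ψ))) := by
      rw [h3, e, map_add, map_smul]
    rw [e2, h2', h3]

theorem exists_isUnit_one_sub_exp_smul [CompleteSpace E] (B : E →L[ℂ] E) :
    ∃ c : ℂ, IsUnit (1 - Complex.exp (-c) • B) := by
  -- With this `c` the norm of `exp (-c) • B` is `‖B‖ / (‖B‖ + 1) < 1`.
  refine ⟨((Real.log (‖B‖ + 1) : ℝ) : ℂ), isUnit_one_sub_of_norm_lt_one ?_⟩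
  have hexp : ‖Complex.exp (-((Real.log (‖B‖ + 1) : ℝ) : ℂ))‖ = (‖B‖ + 1)⁻¹ := by
    rw [Complex.norm_exp]
    simp [Real.exp_neg, Real.exp_log (show (0 : ℝ) < ‖B‖ + 1 by positivity)]
  rw [norm_smul, hexp, inv_mul_lt_one₀ (by positivity)]
  exact lt_add_one _

end Resolvent

/-! ### Laurent coefficients of the resolvent. -/

section Residue

variable {F : Type*} [NormedAddCommGroup F] [NormedSpace ℂ F]

theorem circleIntegral_eq_of_differentiableOn_punctured_ball [CompleteSpace F] {f : ℂ → F}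
    {c : ℂ} {ε : ℝ}
    (hf : DifferentiableOn ℂ f (Metric.ball c ε \ {c})) {r R : ℝ} (hr : 0 < r) (hrR : r ≤ R)
    (hR : R < ε) : (∮ z in C(c, R), f z) = ∮ z in C(c, r), f z := by
  have hsub : Metric.closedBall c R \ Metric.ball c r ⊆ Metric.ball c ε \ {c} := by
    rintro z ⟨h1, h2⟩
    refine ⟨Metric.closedBall_subset_ball hR h1, ?_⟩
    rintro rfl
    exact h2 (Metric.mem_ball_self hr)
  have hopen : IsOpen (Metric.ball c ε \ {c}) := Metric.isOpen_ball.sdiff isClosed_singleton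
  refine Complex.circleIntegral_eq_of_differentiable_on_annulus_off_countable hr hrR
    Set.countable_empty (hf.continuousOn.mono hsub) fun z hz => ?_
  refine hf.differentiableAt (hopen.mem_nhds (hsub ⟨Metric.ball_subset_closedBall hz.1.1, ?_⟩))
  exact fun h => hz.1.2 (Metric.ball_subset_closedBall h)

/-- The integral does not depend on the radius and is of the order of the radius. -/
theorem circleIntegral_eq_zero_of_bounded [CompleteSpace F] {f : ℂ → F} {c : ℂ} {ε C : ℝ}
    (hf : DifferentiableOn ℂ f (Metric.ball c ε \ {c}))
    (hC : ∀ z ∈ Metric.ball c ε \ {c}, ‖f z‖ ≤ C) {R : ℝ} (hR0 : 0 < R) (hR : R < ε) :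
    (∮ z in C(c, R), f z) = 0 := by
  have hb : ∀ r, 0 < r → r ≤ R → ‖∮ z in C(c, R), f z‖ ≤ 2 * Real.pi * r * C := by
    intro r hr hrR
    rw [circleIntegral_eq_of_differentiableOn_punctured_ball hf hr hrR hR]
    refine circleIntegral.norm_integral_le_of_norm_le_const hr.le fun z hz => hC z ⟨?_, ?_⟩
    · exact Metric.closedBall_subset_ball (hrR.trans_lt hR) (Metric.sphere_subset_closedBall hz)
    · rintro rfl
      rw [Metric.mem_sphere, dist_self] at hz
      exact hr.ne hz
  have hlim : Tendsto (fun r : ℝ => 2 * Real.pi * r * C) (𝓝[>] 0) (𝓝 0) := by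
    have : Continuous fun r : ℝ => 2 * Real.pi * r * C := by fun_prop
    simpa using (this.tendsto 0).mono_left nhdsWithin_le_nhds
  refine norm_le_zero_iff.1 (ge_of_tendsto hlim ?_)
  filter_upwards [Ioc_mem_nhdsGT hR0] with r hr
  exact hb r hr.1 hr.2

variable {E : Type*} [NormedAddCommGroup E] [NormedSpace ℂ E] [CompleteSpace E]
  {G : Submodule ℂ (E × E)}

/-- At a pole `0` of the resolvent of `A`, the residue `Γ` of `z⁻¹ R_z(A)` exists and satisfies
`A Γ = P - 1`, where `P` has values in the generalized eigenspace at `0`. -/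
theorem exists_residue_graphResolvent {c : ℂ} {R : E →L[ℂ] E} (hR : IsResolventAt G c R) {ε : ℝ}
    (hε : 0 < ε) (hres : ∀ z ∈ Metric.ball (0 : ℂ) ε \ {0}, z ∈ graphResolventSet G)
    (hd : DifferentiableOn ℂ (graphResolvent G) (Metric.ball 0 ε \ {0})) {n : ℕ} {C : ℝ}
    (hC : ∀ z ∈ Metric.ball (0 : ℂ) ε \ {0}, ‖z ^ n • graphResolvent G z‖ ≤ C) :
    ∃ Γ P : E →L[ℂ] E, IsResidue (fun z : ℂ => z⁻¹ • graphResolvent G z) 0 Γ ∧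
      (∀ φ, (Γ φ, P φ - φ) ∈ G) ∧ ∀ φ, P φ ∈ graphGenEigenspace G 0 := by
  set D : Set ℂ := Metric.ball 0 ε \ {0} with hDdef
  set f : ℤ → ℂ → E →L[ℂ] E := fun k z => z ^ k • graphResolvent G z with hf
  have hfd : ∀ k, DifferentiableOn ℂ (f k) D := by
    intro k z hz
    have hz0 : z ≠ 0 := hz.2
    exact (differentiableAt_zpow.2 (Or.inl hz0)).differentiableWithinAt.smul (hd z hz)
  set r := ε / 2 with hr
  have hr0 : 0 < r := half_pos hε
  have hrε : r < ε := half_lt_self hε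
  have hsph : Metric.sphere (0 : ℂ) r ⊆ D := by
    intro z hz
    refine ⟨Metric.closedBall_subset_ball hrε (Metric.sphere_subset_closedBall hz), ?_⟩
    rintro rfl
    rw [Metric.mem_sphere, dist_self] at hz
    exact hr0.ne hz
  have hfi : ∀ k, CircleIntegrable (f k) 0 r := fun k =>
    ((hfd k).continuousOn.mono hsph).circleIntegrable hr0.le
  set I : ℤ → E →L[ℂ] E := fun k => (2 * Real.pi * Complex.I : ℂ)⁻¹ • ∮ z in C(0, r), f k z with hI
  -- The identity `R_c (c R_z - A R_z) = R_z` with `A R_z = z R_z - 1`, multiplied by `z ^ k` and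
  -- integrated. Using the bounded operator `R = R_c` avoids moving the unbounded `A` through an
  -- integral.
  have hrec : ∀ k : ℤ, R * (c • I k - I (k + 1) +
      ((2 * Real.pi * Complex.I : ℂ)⁻¹ * ∮ z in C(0, r), z ^ k) • 1) = I k := by
    intro k
    have hpt : Set.EqOn (f k) (fun z => R * (c • f k z - f (k + 1) z + z ^ k • 1))
        (Metric.sphere 0 r) := by
      intro z hz
      have hz0 : z ≠ 0 := (hsph hz).2
      obtain ⟨Rz, hRz⟩ := hres z (hsph hz)
      have e1 : R * (c • Rz - (z • Rz - 1)) = Rz := by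
        refine ContinuousLinearMap.ext fun φ => ?_
        exact hR.2 _ _ (hRz.1 φ)
      simp only [hf, hRz.graphResolvent_eq]
      have e2 : c • z ^ k • Rz - z ^ (k + 1) • Rz + z ^ k • (1 : E →L[ℂ] E)
          = z ^ k • (c • Rz - (z • Rz - 1)) := by
        rw [zpow_add_one₀ hz0]
        module
      rw [e2, mul_smul_comm, e1]
    have hzi : CircleIntegrable (fun z : ℂ => z ^ k • (1 : E →L[ℂ] E)) 0 r := by
      refine ContinuousOn.circleIntegrable hr0.le fun z hz => ?_
      exact ((continuousAt_zpow₀ z k (Or.inl (hsph hz).2)).smul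
        continuousAt_const).continuousWithinAt
    have hci : CircleIntegrable (fun z => c • f k z) 0 r :=
      (((hfd k).continuousOn.mono hsph).const_smul c).circleIntegrable hr0.le
    have hi1 : CircleIntegrable (fun z => c • f k z - f (k + 1) z) 0 r := hci.sub (hfi (k + 1))
    have hcomm : (∮ z in C(0, r), R * (c • f k z - f (k + 1) z + z ^ k • 1))
        = R * ∮ z in C(0, r), (c • f k z - f (k + 1) z + z ^ k • 1) := by
      have h1 := (hi1.add hzi).out
      have := (ContinuousLinearMap.mul ℂ (E →L[ℂ] E) R).intervalIntegral_comp_comm h1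
      simp only [circleIntegral]
      refine Eq.trans ?_ this
      simp only [ContinuousLinearMap.mul_apply', mul_smul_comm, Pi.add_apply]
    have hint := circleIntegral.integral_congr hr0.le hpt
    rw [hcomm, circleIntegral.integral_add hi1 hzi, circleIntegral.integral_sub hci (hfi _),
      circleIntegral.integral_smul, circleIntegral.integral_smul_const] at hint
    simp only [hI]
    conv_rhs => rw [hint]
    rw [← mul_smul_comm]
    congr 1
    module
  have hzero : ∀ k : ℕ, n = k → I k = 0 := by
    rintro k rfl
    simp only [hI]
    rw [circleIntegral_eq_zero_of_bounded (hfd _) (fun z hz => ?_) hr0 hrε, smul_zero]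
    · exact C
    · simpa only [hf, zpow_natCast] using hC z hz
  have hstep : ∀ k : ℕ, ∀ φ, (I k φ, I (k + 1) φ) ∈ G := by
    intro k φ
    have h0 : (∮ z in C(0, r), (z : ℂ) ^ (k : ℤ)) = 0 := by
      have := circleIntegral.integral_sub_zpow_of_ne (n := (k : ℤ)) (by omega) 0 0 r
      simpa using this
    have h1 := hrec k
    rw [h0, mul_zero, zero_smul, add_zero] at h1
    rw [hR.mem_iff]
    exact DFunLike.congr_fun h1 φ
  -- Descent from `I n = 0` along `A (I k) = I (k + 1)`.
  have hker : ∀ m k : ℕ, k + m = n → ∀ φ, I k φ ∈ graphKerPow G 0 m := by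
    intro m
    induction m with
    | zero =>
      intro k hk φ
      rw [hzero k (by omega)]
      exact Submodule.zero_mem _
    | succ m ih =>
      intro k hk φ
      refine ⟨I (k + 1) φ, hstep k φ, ?_⟩
      rw [zero_smul, sub_zero]
      exact_mod_cast ih (k + 1) (by omega) φ
  -- At `k = -1` the scalar integral is `2 π i` instead of `0`, which produces the `-1` in `A Γ = P
  -- - 1`.
  refine ⟨I (-1), I 0, ⟨ε, hε, ?_, fun s hs0 hs => ?_⟩, fun φ => ?_, fun φ => ?_⟩
  · simpa only [hf, zpow_neg_one] using hfd (-1)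
  · have h1 : (∮ z in C(0, s), z⁻¹ • graphResolvent G z) = ∮ z in C(0, r), f (-1) z := by
      simp only [← zpow_neg_one]
      rcases le_total s r with h | h
      · exact (circleIntegral_eq_of_differentiableOn_punctured_ball (hfd (-1)) hs0 h hrε).symm
      · exact circleIntegral_eq_of_differentiableOn_punctured_ball (hfd (-1)) hr0 h hs
    rw [h1]
  · have h0 : (∮ z in C(0, r), (z : ℂ) ^ (-1 : ℤ)) = 2 * Real.pi * Complex.I := by
      have := circleIntegral.integral_sub_center_inv 0 hr0.ne'
      simpa using this
    have h1 := hrec (-1)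
    have hpi : (2 * Real.pi * Complex.I : ℂ) ≠ 0 := Complex.two_pi_I_ne_zero
    rw [h0, inv_mul_cancel₀ hpi, one_smul, neg_add_cancel] at h1
    rw [hR.mem_iff, sub_sub_eq_add_sub, add_sub_right_comm]
    exact DFunLike.congr_fun h1 φ
  · exact mem_graphGenEigenspace.2 ⟨n, by exact_mod_cast hker n 0 (zero_add n) φ⟩

end Residue

/-! ### The resolvent of `A^{⊙*}` and its pole at `0`. -/

namespace C0Semigroup

variable {X : Type*} [NormedAddCommGroup X] [NormedSpace ℂ X] [CompleteSpace X]

/-- The resolvent set of `A^{⊙*}` is nonempty, and the resolvent factors through `j`. -/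
theorem IsPerturbation.exists_resolvent {T₀ T : C0Semigroup X} (hrefl : T₀.SunReflexive)
    {L : X →L[ℂ] T₀.SunStar} (hT : IsPerturbation T₀ L T) :
    ∃ (c : ℂ) (S : T₀.SunStar →L[ℂ] X), IsResolventAt hT.sunStarGenerator c (T₀.j.comp S) := by
  set 𝒮 := T₀.sunSemigroupOn T hT.sun_eq
  set B : T₀.SunStar →L[ℂ] T₀.SunStar := ContinuousLinearMap.precomp ℂ (𝒮 1) with hB
  obtain ⟨c, hc⟩ := exists_isUnit_one_sub_exp_smul B
  obtain ⟨u, hu⟩ : IsUnit (1 - Complex.exp (-(c * (1 : ℝ≥0))) • B) := by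
    have h1 : c * ((1 : ℝ≥0) : ℝ) = c := by simp
    rw [h1]
    exact hc
  have hu1 : ∀ φ, u.1 φ = φ - Complex.exp (-(c * (1 : ℝ≥0))) • φ.comp (𝒮 1) := fun φ => by
    rw [hu]; rfl
  have hu2 : ∀ φ, u.1 ((↑u⁻¹ : T₀.SunStar →L[ℂ] T₀.SunStar) φ) = φ :=
    DFunLike.congr_fun u.mul_inv
  have hu3 : ∀ φ, (↑u⁻¹ : T₀.SunStar →L[ℂ] T₀.SunStar) (u.1 φ) = φ :=
    DFunLike.congr_fun u.inv_mul
  obtain ⟨U, hU⟩ := 𝒮.exists_truncatedLaplace c 1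
  -- The truncated transform over `[0, 1]` inverts `c - A` up to the factor `1 - exp (-c)
  -- T^{⊙*}(1)`, and `c` was chosen to make that factor invertible.
  let R : T₀.SunStar →L[ℂ] T₀.SunStar := (ContinuousLinearMap.precomp ℂ U).comp (u⁻¹).1
  have hR : ∀ φ, (R φ, c • R φ - φ) ∈ hT.sunStarGenerator := by
    intro φ
    have h1 := truncatedLaplace_mem_weakStarGenerator hU ((↑u⁻¹ : T₀.SunStar →L[ℂ] T₀.SunStar) φ)
    have h2 := hu1 ((↑u⁻¹ : T₀.SunStar →L[ℂ] T₀.SunStar) φ)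
    rw [hu2] at h2
    rw [sub_add, ← h2] at h1
    exact h1
  obtain ⟨S, hS⟩ := T₀.exists_lift_j R fun φ => hT.exists_eq_j hrefl (hR φ)
  have hSR : T₀.j.comp S = R := ContinuousLinearMap.ext hS
  refine ⟨c, S, hSR ▸ ⟨hR, fun φ ψ h => ?_⟩⟩
  -- The difference `d = R (c φ - ψ) - φ` satisfies `A d = c d`, so the left-inverse identity gives
  -- `u d = 0`, hence `d = 0`.
  have h1 := Submodule.sub_mem _ (hR (c • φ - ψ)) h
  rw [Prod.mk_sub_mk] at h1
  have h2 := comp_truncatedLaplace_of_mem_weakStarGenerator hU h1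
  have e : c • (R (c • φ - ψ) - φ) - (c • R (c • φ - ψ) - (c • φ - ψ) - ψ) = 0 := by module
  rw [e, ← hu1] at h2
  have h3 := hu3 (R (c • φ - ψ) - φ)
  rw [← h2, ContinuousLinearMap.zero_comp, map_zero] at h3
  exact sub_eq_zero.1 h3.symm

/-- Let `j ∘ S` be the resolvent of `A^{⊙*}` at `c`. If `T₀` is eventually compact and `L` is
compact, then `1 + w S j` is invertible modulo compact operators for all `w`. -/
theorem IsPerturbation.exists_parametrix {T₀ T : C0Semigroup X} (hrefl : T₀.SunReflexive)
    (hcpt : T₀.EventuallyCompact) {L : X →L[ℂ] T₀.SunStar} (hL : IsCompactOperator L)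
    (hT : IsPerturbation T₀ L T) {c : ℂ} {S : T₀.SunStar →L[ℂ] X}
    (hS : IsResolventAt hT.sunStarGenerator c (T₀.j.comp S)) (w : ℂ) :
    ∃ P : X →L[ℂ] X, IsCompactOperator (P * (1 + w • S.comp T₀.j) - 1 : X →L[ℂ] X) ∧
      IsCompactOperator ((1 + w • S.comp T₀.j) * P - 1 : X →L[ℂ] X) := by
  obtain ⟨t, -, ht⟩ := hcpt
  set z : ℂ := c + w with hz
  set a : ℂ := Complex.exp (-(z * t)) with ha
  obtain ⟨U, hU⟩ := T₀.sunSemigroup.exists_truncatedLaplace z t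
  have hV := fun φ => truncatedLaplace_mem_weakStarGenerator hU φ
  -- Formally `1 + w Q = (c - A)⁻¹ (z - A)` with `z = c + w`, whose inverse is `1 - w (z - A)⁻¹`.
  -- Replacing `(z - A)⁻¹` by the truncated transform of `T₀` leaves errors that contain `T₀ t` or
  -- `L` as a factor, and both are compact.
  obtain ⟨V, hVj⟩ := T₀.exists_lift_j (ContinuousLinearMap.precomp ℂ U)
    fun φ => C0Semigroup.exists_eq_j hrefl (hV φ)
  have hVj' : ∀ φ, φ.comp U = T₀.j (V φ) := fun φ => (hVj φ).symm
  set Q : X →L[ℂ] X := S.comp T₀.j with hQ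
  set W : X →L[ℂ] X := V.comp T₀.j with hW
  have hleft : ∀ x, W (x + w • Q x) = Q x - a • T₀ t (Q x) - V (L (Q x)) := by
    intro x
    have h1 : (T₀.j (S (T₀.j x)), c • T₀.j (S (T₀.j x)) - T₀.j x) ∈ hT.sunStarGenerator :=
      hS.1 (T₀.j x)
    rw [hT.j_mem_generator_iff] at h1
    have h2 := comp_truncatedLaplace_of_mem_weakStarGenerator hU h1
    rw [hVj', j_comp_sunSemigroupOn] at h2
    have h3 := T₀.j_injective (h2.trans (show _ = T₀.j (Q x - a • T₀ t (Q x)) by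
      rw [map_sub, map_smul]; rfl))
    have e : z • T₀.j (S (T₀.j x)) - (c • T₀.j (S (T₀.j x)) - T₀.j x - L (S (T₀.j x)))
        = T₀.j (x + w • Q x) + L (Q x) := by
      rw [map_add, map_smul, hz]
      simp only [hQ, ContinuousLinearMap.comp_apply]
      module
    rw [e, map_add] at h3
    exact eq_sub_of_add_eq h3
  have hright : ∀ x, W x + w • Q (W x) = Q x - a • Q (T₀ t x) - S (L (W x)) := by
    intro x
    have h1 := hV (T₀.j x)
    rw [hVj', j_comp_sunSemigroupOn] at h1
    have h2 : (T₀.j (W x), (z • T₀.j (W x) - T₀.j x + a • T₀.j (T₀ t x)) + L (W x))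
        ∈ hT.sunStarGenerator := by
      rw [hT.j_mem_generator_iff, add_sub_cancel_right]
      exact h1
    have h3 := T₀.j_injective (hS.2 _ _ h2)
    have e : c • T₀.j (W x) - ((z • T₀.j (W x) - T₀.j x + a • T₀.j (T₀ t x)) + L (W x))
        = T₀.j x - a • T₀.j (T₀ t x) - L (W x) - w • T₀.j (W x) := by
      rw [hz]
      module
    rw [e, map_sub, map_sub, map_sub, map_smul, map_smul, sub_eq_iff_eq_add] at h3
    exact h3.symm
  refine ⟨1 - w • W, ?_, ?_⟩
  · have e : (1 - w • W) * (1 + w • Q) - 1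
        = w • (a • (T₀ t).comp Q + V.comp (L.comp Q)) := by
      refine ContinuousLinearMap.ext fun x => ?_
      have : ((1 - w • W) * (1 + w • Q) - 1) x
          = (x + w • Q x) - w • W (x + w • Q x) - x := rfl
      rw [this, hleft]
      simp only [smul_apply, add_apply, ContinuousLinearMap.comp_apply]
      module
    rw [e]
    exact (((ht.comp_clm Q).smul a).add ((hL.comp_clm Q).clm_comp V)).smul w
  · have e : (1 + w • Q) * (1 - w • W) - 1
        = w • (a • Q.comp (T₀ t) + S.comp (L.comp W)) := by
      refine ContinuousLinearMap.ext fun x => ?_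
      have : ((1 + w • Q) * (1 - w • W) - 1) x
          = (x - w • W x) + w • Q (x - w • W x) - x := rfl
      have h1 : (x - w • W x) + w • Q (x - w • W x) - x
          = w • Q x - w • (W x + w • Q (W x)) := by
        rw [map_sub, map_smul]
        module
      rw [this, h1, hright]
      simp only [smul_apply, add_apply, ContinuousLinearMap.comp_apply]
      module
    rw [e]
    exact (((ht.clm_comp Q).smul a).add ((hL.comp_clm W).clm_comp S)).smul w

/-- The resolvent of `A^{⊙*}` is holomorphic in a punctured neighbourhood of `0`, with at most a
pole at `0`. -/
theorem IsPerturbation.exists_pole_resolvent {T₀ T : C0Semigroup X} (hrefl : T₀.SunReflexive)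
    (hcpt : T₀.EventuallyCompact) {L : X →L[ℂ] T₀.SunStar} (hL : IsCompactOperator L)
    (hT : IsPerturbation T₀ L T) {c : ℂ} {S : T₀.SunStar →L[ℂ] X}
    (hS : IsResolventAt hT.sunStarGenerator c (T₀.j.comp S)) :
    ∃ (ε : ℝ) (n : ℕ) (C : ℝ), 0 < ε ∧
      (∀ z ∈ Metric.ball (0 : ℂ) ε \ {0}, z ∈ graphResolventSet hT.sunStarGenerator) ∧
      DifferentiableOn ℂ (graphResolvent hT.sunStarGenerator) (Metric.ball 0 ε \ {0}) ∧
      ∀ z ∈ Metric.ball (0 : ℂ) ε \ {0}, ‖z ^ n • graphResolvent hT.sunStarGenerator z‖ ≤ C := by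
  set Q : X →L[ℂ] X := S.comp T₀.j with hQ
  -- The family is `1 + (z - c) Q`, so `z = 0` corresponds to the parameter `-c`.
  obtain ⟨n, H, hHc, hH⟩ := exists_pole_one_add_smul Q
    (hT.exists_parametrix hrefl hcpt hL hS) (-c)
  have hmap : Tendsto (fun z : ℂ => z - c) (𝓝 0) (𝓝 (-c)) := by
    have : Continuous fun z : ℂ => z - c := by fun_prop
    simpa using this.tendsto 0
  have hmap' : Tendsto (fun z : ℂ => z - c) (𝓝[≠] 0) (𝓝[≠] (-c)) := by
    refine tendsto_nhdsWithin_iff.2 ⟨hmap.mono_left nhdsWithin_le_nhds, ?_⟩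
    filter_upwards [self_mem_nhdsWithin] with z hz hzc
    exact hz (by simpa using (sub_eq_iff_eq_add.1 hzc))
  have hbd : ∀ᶠ z in 𝓝 (0 : ℂ), ‖H (z - c)‖ ≤ ‖H (-c)‖ + 1 :=
    (hHc.tendsto.comp hmap).norm.eventually_le_const (lt_add_one _)
  obtain ⟨ε, hε, hball⟩ := Metric.eventually_nhds_iff_ball.1 (eventually_nhdsWithin_iff.1
    ((hmap'.eventually hH).and (hbd.filter_mono nhdsWithin_le_nhds)))
  have key : ∀ z ∈ Metric.ball (0 : ℂ) ε \ {0}, IsUnit (1 + (z - c) • Q) ∧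
      IsResolventAt hT.sunStarGenerator z (T₀.j.comp ((Ring.inverse (1 + (z - c) • Q)).comp S)) ∧
      z ^ n • Ring.inverse (1 + (z - c) • Q) = H (z - c) ∧ ‖H (z - c)‖ ≤ ‖H (-c)‖ + 1 := by
    rintro z ⟨hz, hz0⟩
    have hz0' : z ≠ 0 := hz0
    obtain ⟨⟨h1, h2⟩, h3⟩ := hball z hz hz0
    rw [sub_neg_eq_add, sub_add_cancel] at h1 h2
    have hne : z ^ n ≠ 0 := pow_ne_zero _ hz0'
    have hu : IsUnit (1 + (z - c) • Q) := by
      refine ⟨⟨_, (z ^ n)⁻¹ • H (z - c), ?_, ?_⟩, rfl⟩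
      · rw [mul_smul_comm, h1, inv_smul_smul₀ hne]
      · rw [smul_mul_assoc, h2, inv_smul_smul₀ hne]
    refine ⟨hu, hS.of_factor (Ring.mul_inverse_cancel _ hu) (Ring.inverse_mul_cancel _ hu), ?_, h3⟩
    calc z ^ n • Ring.inverse (1 + (z - c) • Q)
        = (H (z - c) * (1 + (z - c) • Q)) * Ring.inverse (1 + (z - c) • Q) := by
          rw [h2, smul_mul_assoc, one_mul]
      _ = H (z - c) := by rw [mul_assoc, Ring.mul_inverse_cancel _ hu, mul_one]
  refine ⟨ε, n, ‖T₀.j‖ * ((‖H (-c)‖ + 1) * ‖S‖), hε, fun z hz => ⟨_, (key z hz).2.1⟩, ?_, ?_⟩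
  · have h1 : DifferentiableOn ℂ (fun z : ℂ => T₀.j.comp ((Ring.inverse (1 + (z - c) • Q)).comp S))
        (Metric.ball 0 ε \ {0}) := by
      intro z hz
      obtain ⟨u, hu⟩ := (key z hz).1
      have h2 : DifferentiableAt ℂ (fun z : ℂ => 1 + (z - c) • Q) z := by fun_prop
      have h3 : DifferentiableAt ℂ (fun z : ℂ => Ring.inverse (1 + (z - c) • Q)) z := by
        have h4 : DifferentiableAt ℂ Ring.inverse (1 + (z - c) • Q) :=
          hu ▸ (analyticAt_inverse (𝕜 := ℂ) u).differentiableAt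
        exact h4.comp z h2
      exact ((differentiableAt_const _).clm_comp
        (h3.clm_comp (differentiableAt_const _))).differentiableWithinAt
    exact h1.congr fun z hz => (key z hz).2.1.graphResolvent_eq
  · intro z hz
    obtain ⟨-, h1, h2, h3⟩ := key z hz
    have e : z ^ n • graphResolvent hT.sunStarGenerator z = T₀.j.comp ((H (z - c)).comp S) := by
      rw [h1.graphResolvent_eq, ← h2, ContinuousLinearMap.smul_comp, ContinuousLinearMap.comp_smul]
    rw [e]
    refine (ContinuousLinearMap.opNorm_comp_le _ _).trans ?_
    gcongr
    refine (ContinuousLinearMap.opNorm_comp_le _ _).trans ?_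
    gcongr

end C0Semigroup

theorem theorem3p5 {X : Type*} [NormedAddCommGroup X] [NormedSpace ℂ X] [CompleteSpace X] (p : ℕ)
    (T₀ : C0Semigroup X) (hrefl : T₀.SunReflexive) (hcpt : T₀.EventuallyCompact)
    (L : X →L[ℂ] T₀.SunStar) (hL : IsCompactOperator L)
    (Lp : (Fin p → ℂ) →L[ℂ] T₀.SunStar)
    (T : C0Semigroup X) (hT : C0Semigroup.IsPerturbation T₀ L T)
    (TT : C0Semigroup (X × (Fin p → ℂ)))
    (hTT : C0Semigroup.IsPerturbation (T₀.augment p) (C0Semigroup.augmentPerturbation L Lp) TT) :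
    (∀ μ : ℂ, μ ≠ 0 →
      graphGenEigenspace hTT.sunStarGenerator μ
        = ((graphGenEigenspace hT.sunStarGenerator μ).prod ⊥).map
            (T₀.augmentEquiv p).toLinearMap) ∧
    ∃ Γ : T₀.SunStar →L[ℂ] T₀.SunStar,
      (∀ᶠ z in 𝓝[≠] (0 : ℂ), z ∈ graphResolventSet hT.sunStarGenerator) ∧
      IsResidue (fun z : ℂ => z⁻¹ • graphResolvent hT.sunStarGenerator z) 0 Γ ∧
      (∀ φ, Γ φ ∈ T₀.sunSun) ∧
      graphGenEigenspace hTT.sunStarGenerator 0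
        = ((graphGenEigenspace hT.sunStarGenerator 0).prod ⊥).map
              (T₀.augmentEquiv p).toLinearMap
          ⊔ LinearMap.range ((T₀.augmentEquiv p).toLinearMap
              ∘ₗ ((Γ ∘L Lp).toLinearMap.prod LinearMap.id)) ∧
      Disjoint
        (((graphGenEigenspace hT.sunStarGenerator 0).prod ⊥).map
          (T₀.augmentEquiv p).toLinearMap)
        (LinearMap.range ((T₀.augmentEquiv p).toLinearMap
          ∘ₗ ((Γ ∘L Lp).toLinearMap.prod LinearMap.id))) := by
  have hG : ∀ φ ψ α β, (T₀.augmentEquiv p (φ, α), T₀.augmentEquiv p (ψ, β))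
      ∈ hTT.sunStarGenerator ↔ (φ, ψ - Lp α) ∈ hT.sunStarGenerator ∧ β = 0 :=
    fun φ ψ α β => C0Semigroup.augmentEquiv_mem_generator_iff hrefl hT hTT
  obtain ⟨c, S, hS⟩ := hT.exists_resolvent hrefl
  obtain ⟨ε, n, C, hε, hres, hd, hC⟩ := hT.exists_pole_resolvent hrefl hcpt hL hS
  obtain ⟨Γ, P, hΓres, hΓ, hP⟩ := exists_residue_graphResolvent hS hε hres hd hC
  refine ⟨fun μ hμ => graphGenEigenspace_triangular_of_ne_zero hG hμ, Γ, ?_, hΓres, fun φ => ?_,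
    graphGenEigenspace_triangular_zero hG hΓ hP, disjoint_map_prod_bot_range _ _ _⟩
  · exact eventually_nhdsWithin_iff.2 (Metric.eventually_nhds_iff_ball.2
      ⟨ε, hε, fun z hz hz0 => hres z ⟨hz, hz0⟩⟩)
  -- `Γ φ` lies in the domain of `A^{⊙*}`, and this domain is contained in the range of `j`.
  · obtain ⟨x, hx⟩ := hT.exists_eq_j hrefl (hΓ φ)
    rw [hx]
    exact T₀.range_j_le_sunSun ⟨x, rfl⟩
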